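/- A two-party quantum protocol has finite-dimensional spaces $\mathcal A$ (Alice), $\mathcal M$ (messages), $\mathcal B$ (Bob), started in a product of fixed basis states. In each of finitely many rounds Alice applies a unitary to $\mathcal A\otimes\mathcal M$, and then Bob applies a unitary to $\mathcal M\otimes\mathcal B$. At the end honest Alice and honest Bob measure POVMs on $\mathcal A$ and on $\mathcal B$ respectively, "Abort" being one of the possible outcomes. A dishonest party may use a private space of any finite dimension, arbitrary unitaries, and an arbitrary final POVM on that space and $\mathcal M$. In a *1-out-of-2 random oblivious transfer* protocol Alice outputs $(x_0,x_1)\in\{0,1\}^2$ or Abort and Bob outputs $(b,y)\in\{0,1\}^2$ or Abort; if both are honest, nobody aborts, $y=x_b$, and $(x_0,x_1,b)$ is uniformly distributed. In a *1-out-of-2 oblivious transfer* protocol *with inputs* Alice has input $(x_0,x_1)$ and Bob has input $b$, Alice may abort, and Bob outputs $y$ or Abort; if both are honest, nobody aborts and $y=x_b$. In both cases let $$A_{OT}=\sup\Pr[\text{Alice guesses } b \text{ and Bob does not abort}],\qquad B_{OT}=\sup\Pr[\text{Bob guesses }(x_0,x_1)\text{ and Alice does not abort}],$$ where the suprema are over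 all strategies of a dishonest Alice against honest Bob, and of a dishonest Bob against honest Alice (with inputs, the inputs of the honest party are uniformly random). The bias is $\varepsilon=\max\{A_{OT}-\tfrac12,\,B_{OT}-\tfrac12\}$. **Theorem.** The function $g(x)=x(2x-1)^2$ maps $[\frac12,1]$ bijectively onto $[0,1]$, and its inverse is given for $z\in[\frac2{27},1]$ by $$f(z)=\tfrac16\left(3\sqrt3\sqrt{27z^2-2z}+27z-1\right)^{1/3}+\tfrac16\left(3\sqrt3\sqrt{27z^2-2z}+27z-1\right)^{-1/3}+\tfrac13 .$$ In every quantum 1-out-of-2 oblivious transfer protocol, random or with inputs, $B_{OT}\in[\frac12,1]$ and $$A_{OT}\cdot f(B_{OT})\ \ge\ \tfrac12 ,$$ and consequently the bias satisfies $$\varepsilon\ \ge\ \tfrac12\left(\sqrt{\tfrac12+2\sqrt2}-\sqrt{\tfrac12}\right)-\tfrac12\ \approx\ 0.0586,$$ where the approximation is correct to within $5\cdot10^{-5}$. -/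

import Mathlib

open scoped Matrix Kronecker ComplexOrder

noncomputable section

namespace QuantumOT

/-! A finite-dimensional space is `ℂ^H` for a finite type `H` that labels its computational basis;
`ℂ^A ⊗ ℂ^M` is `ℂ^(A × M)`.  `A`, `M`, `B` label the private space of Alice, the message space and
the private space of Bob. -/

/-- A measurement (POVM) on `ℂ^H` with outcomes in the finite set `O`. -/
structure POVM (O H : Type) [Fintype O] [Fintype H] [DecidableEq H] where
  op : O → Matrix H H ℂ
  posSemidef : ∀ o, (op o).PosSemidef
  sum_eq_one : ∑ o, op o = 1

/-- The probability `⟨ψ| E |ψ⟩` of the effect `E` in the state `ψ`. -/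
def prob {H : Type} [Fintype H] (ψ : H → ℂ) (E : Matrix H H ℂ) : ℝ :=
  (star ψ ⬝ᵥ (E *ᵥ ψ)).re

/-- The operator `X ⊗ Y` on `(A ⊗ M) ⊗ B`, regarded as an operator on `A ⊗ M ⊗ B`. -/
def tensorLeft {A M B : Type} (X : Matrix (A × M) (A × M) ℂ) (Y : Matrix B B ℂ) :
    Matrix (A × M × B) (A × M × B) ℂ :=
  (X ⊗ₖ Y).reindex (Equiv.prodAssoc A M B) (Equiv.prodAssoc A M B)

/-- The joint state after `n` rounds: it starts in `|a₀⟩|m₀⟩|b₀⟩`; in each round Alice applies a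
unitary to `A ⊗ M` and then Bob applies one to `M ⊗ B`.  In round `n + 1` these are `U n`, `V n`. -/
def run {A M B : Type} [Fintype A] [DecidableEq A] [Fintype M] [DecidableEq M]
    [Fintype B] [DecidableEq B]
    (U : ℕ → Matrix.unitaryGroup (A × M) ℂ) (V : ℕ → Matrix.unitaryGroup (M × B) ℂ)
    (a₀ : A) (m₀ : M) (b₀ : B) : ℕ → (A × M × B → ℂ)
  | 0 => Pi.single (a₀, m₀, b₀) 1
  | n + 1 =>
      ((1 : Matrix A A ℂ) ⊗ₖ (V n : Matrix (M × B) (M × B) ℂ)) *ᵥ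
        (tensorLeft (U n : Matrix (A × M) (A × M) ℂ) (1 : Matrix B B ℂ) *ᵥ
          run U V a₀ m₀ b₀ n)

/-- An honest Alice: initial basis state, unitaries, and a final measurement on her private space. -/
structure HonestAlice (O A M : Type) [Fintype O] [Fintype A] [DecidableEq A]
    [Fintype M] [DecidableEq M] where
  start : A
  unitary : ℕ → Matrix.unitaryGroup (A × M) ℂ
  meas : POVM O A

/-- An honest Bob: initial basis state, unitaries, and a final measurement on his private space. -/
structure HonestBob (O M B : Type) [Fintype O] [Fintype M] [DecidableEq M]
    [Fintype B] [DecidableEq B] where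
  start : B
  unitary : ℕ → Matrix.unitaryGroup (M × B) ℂ
  meas : POVM O B

/-- A cheating Alice with private space `A`.  She obtains her guess by measuring `A ⊗ M`, since the
last message of Bob is sent to her. -/
structure CheatingAlice (O A M : Type) [Fintype O] [Fintype A] [DecidableEq A]
    [Fintype M] [DecidableEq M] where
  start : A
  unitary : ℕ → Matrix.unitaryGroup (A × M) ℂ
  guess : POVM O (A × M)

/-- A cheating Bob with private space `B`.  He obtains his guess by measuring `M ⊗ B`, since he need
not part with the message register after his last operation. -/
structure CheatingBob (O M B : Type) [Fintype O] [Fintype M] [DecidableEq M]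
    [Fintype B] [DecidableEq B] where
  start : B
  unitary : ℕ → Matrix.unitaryGroup (M × B) ℂ
  guess : POVM O (M × B)

section Outcomes

variable {OA OB A M B : Type} [Fintype OA] [Fintype OB] [Fintype A] [DecidableEq A]
  [Fintype M] [DecidableEq M] [Fintype B] [DecidableEq B]

/-- Probability that honest Alice outputs `o` and honest Bob outputs `o'` after `n` rounds. -/
def honestProb (n : ℕ) (m₀ : M) (P : HonestAlice OA A M) (Q : HonestBob OB M B)
    (o : OA) (o' : OB) : ℝ :=
  prob (run P.unitary Q.unitary P.start m₀ Q.start n)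
    (P.meas.op o ⊗ₖ ((1 : Matrix M M ℂ) ⊗ₖ Q.meas.op o'))

/-- Probability that cheating Alice guesses `o` and honest Bob outputs `o'` after `n` rounds. -/
def cheatAliceProb (n : ℕ) (m₀ : M) (S : CheatingAlice OA A M) (Q : HonestBob OB M B)
    (o : OA) (o' : OB) : ℝ :=
  prob (run S.unitary Q.unitary S.start m₀ Q.start n)
    (tensorLeft (S.guess.op o) (Q.meas.op o'))

/-- Probability that honest Alice outputs `o` and cheating Bob guesses `o'` after `n` rounds. -/
def cheatBobProb (n : ℕ) (m₀ : M) (P : HonestAlice OA A M) (S : CheatingBob OB M B)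
    (o : OA) (o' : OB) : ℝ :=
  prob (run P.unitary S.unitary P.start m₀ S.start n)
    (P.meas.op o ⊗ₖ S.guess.op o')

end Outcomes

/-- The bit `x_b` of `x = (x₀, x₁)`. -/
def bitAt (x : Bool × Bool) (b : Bool) : Bool := if b then x.2 else x.1

/-- A 1-out-of-2 quantum random oblivious transfer protocol.  Alice outputs `(x₀, x₁)`, Bob outputs
`(b, y)`; `none` means Abort.  If both are honest, then nobody aborts, `y = x_b`, and `(x₀, x₁, b)`
is uniformly distributed; so the output of Alice is independent of `b`, and that of Bob is
independent of the bit he did not choose. -/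
structure RandomOT (A M B : Type) [Fintype A] [DecidableEq A] [Fintype M] [DecidableEq M]
    [Fintype B] [DecidableEq B] where
  rounds : ℕ
  msgStart : M
  alice : HonestAlice (Option (Bool × Bool)) A M
  bob : HonestBob (Option (Bool × Bool)) M B
  honest : ∀ (x : Bool × Bool) (b y : Bool),
    honestProb rounds msgStart alice bob (some x) (some (b, y)) = if y = bitAt x b then 1 / 8 else 0

/-- A 1-out-of-2 quantum oblivious transfer protocol with inputs `x = (x₀, x₁)` for Alice and `b`
for Bob.  Alice aborts (`none`) or not (`some ()`), and Bob outputs `some y` or aborts (`none`).  If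
both are honest, then nobody aborts and `y = x_b`.  The demand that an honest Alice learns nothing
about `b` and an honest Bob nothing about the other bit is not imposed, so that this class contains
every protocol that meets it. -/
structure InputOT (A M B : Type) [Fintype A] [DecidableEq A] [Fintype M] [DecidableEq M]
    [Fintype B] [DecidableEq B] where
  rounds : ℕ
  msgStart : M
  alice : Bool × Bool → HonestAlice (Option Unit) A M
  bob : Bool → HonestBob (Option Bool) M B
  honest : ∀ (x : Bool × Bool) (b : Bool),
    honestProb rounds msgStart (alice x) (bob b) (some ()) (some (bitAt x b)) = 1

section Cheating

variable {A M B : Type} [Fintype A] [DecidableEq A] [Fintype M] [DecidableEq M]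
  [Fintype B] [DecidableEq B]

/-- `A_OT`: the supremum, over all strategies of Alice, with a private space of any finite
dimension, of Pr[Alice guesses `b` and Bob does not abort]. -/
def RandomOT.aliceCheat (P : RandomOT A M B) : ℝ :=
  sSup {p : ℝ | ∃ (A' : Type) (_ : Fintype A') (_ : DecidableEq A') (S : CheatingAlice Bool A' M),
    p = ∑ b : Bool, ∑ y : Bool, cheatAliceProb P.rounds P.msgStart S P.bob b (some (b, y))}

/-- `B_OT`: the supremum, over all strategies of Bob, with a private space of any finite
dimension, of Pr[Bob guesses `(x₀, x₁)` and Alice does not abort]. -/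
def RandomOT.bobCheat (P : RandomOT A M B) : ℝ :=
  sSup {p : ℝ | ∃ (B' : Type) (_ : Fintype B') (_ : DecidableEq B')
    (S : CheatingBob (Bool × Bool) M B'),
    p = ∑ x : Bool × Bool, cheatBobProb P.rounds P.msgStart P.alice S (some x) x}

/-- The bias `max (A_OT - 1/2) (B_OT - 1/2)`. -/
def RandomOT.bias (P : RandomOT A M B) : ℝ :=
  max (P.aliceCheat - 1 / 2) (P.bobCheat - 1 / 2)

/-- `A_OT` for a protocol with inputs; the input `b`, unknown to Alice, is uniformly random. -/
def InputOT.aliceCheat (P : InputOT A M B) : ℝ :=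
  sSup {p : ℝ | ∃ (A' : Type) (_ : Fintype A') (_ : DecidableEq A') (S : CheatingAlice Bool A' M),
    p = ∑ b : Bool, (1 / 2) *
      ∑ y : Bool, cheatAliceProb P.rounds P.msgStart S (P.bob b) b (some y)}

/-- `B_OT` for a protocol with inputs; the inputs `(x₀, x₁)`, unknown to Bob, are uniformly
random. -/
def InputOT.bobCheat (P : InputOT A M B) : ℝ :=
  sSup {p : ℝ | ∃ (B' : Type) (_ : Fintype B') (_ : DecidableEq B')
    (S : CheatingBob (Bool × Bool) M B'),
    p = ∑ x : Bool × Bool, (1 / 4) *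
      cheatBobProb P.rounds P.msgStart (P.alice x) S (some ()) x}

/-- The bias `max (A_OT - 1/2) (B_OT - 1/2)`. -/
def InputOT.bias (P : InputOT A M B) : ℝ :=
  max (P.aliceCheat - 1 / 2) (P.bobCheat - 1 / 2)

end Cheating

/-- `g(x) = x (2x - 1)²`. -/
def g (x : ℝ) : ℝ := x * (2 * x - 1) ^ 2

/-- The closed form of the inverse of `g`; over the reals it is meaningful for `z ≥ 2/27`. -/
def f (z : ℝ) : ℝ :=
  1 / 6 * (3 * √3 * √(27 * z ^ 2 - 2 * z) + 27 * z - 1) ^ (1 / 3 : ℝ) +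
    1 / 6 * (3 * √3 * √(27 * z ^ 2 - 2 * z) + 27 * z - 1) ^ (-(1 / 3) : ℝ) + 1 / 3

/-- The lower bound on the bias. -/
def biasBound : ℝ := 1 / 2 * (√(1 / 2 + 2 * √2) - √(1 / 2)) - 1 / 2

end QuantumOT

end

set_option linter.unusedSectionVars false


namespace QuantumOT

/-! ### The functions `g` and `f` -/

/-! The proof plays two cheating games against each other. In Alice's game she guesses the bit `b`,
and her optimum is `A_OT`. In the auxiliary game of Bob a uniformly random bit `c` is put to him
after the protocol, and he has to guess `x_c`; let `v` be his optimum. Honest parties win both games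
in a correlated way: if Alice's question is `c`, then with probability 1/2 it is the bit that Bob
chose, and then his output is the right answer. Kitaev's duality argument (`honest_le_mul`) shows
that this honest probability 1/2 is at most `v * A_OT`.

For that argument each cheater's optimum is written as a semidefinite program over the states of the
message and the honest party's space. A cheater with enough private space can reach every sequence
of states that is consistent with the honest moves (`exists_strategy`), because two purifications of
one state differ by a unitary on the purifying side. Strong duality (`exists_dual`) then gives
positive operators `Z i` on Bob's space and `W i` on Alice's space that certify both optima up to an
arbitrarily small error. The expectation of `W ⊗ 1 ⊗ Z` along the honest run does not increase from
the end of the protocol back to its start (read backwards, each move can be replaced by the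
preceding operator, which dominates). At the end it is at least the honest probability; at the start
the state is a product, so that it factors into the two certified values.

It remains to bound `v` by `B_OT`. Suppose that Bob guesses `x_0` with one projective measurement
and `x_1` with another, with average success `p ≥ 1/2`. Performing both in succession, in the better
of the two orders, yields both bits with probability at least `g p = p (2p - 1)²`
(`sequential_projections`, `exists_povm_guess_both`). Hence `g v ≤ B_OT` whenever `v ≥ 1/2`, so `v ≤
f B_OT`, and the product bound follows (`half_le_mul_f`). It is proved for protocols that start in
an arbitrary product vector, so that it also covers inputs: they are held in superposition in
registers of the honest parties which control their unitaries.

The bound on the bias is the value `c` with `c * f c = 1/2`: if both cheating probabilities were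
below `c + 0`, monotonicity of `g` would make the product too small (`biasBound_le_of_product`). -/

theorem g_sub (x y : ℝ) :
    g y - g x = (y - x) * (4 * (y ^ 2 + x * y + x ^ 2) - 4 * (x + y) + 1) := by
  unfold g; ring

theorem g_strictMonoOn : StrictMonoOn g (Set.Ici (1 / 2)) := by
  intro x hx y hy hxy
  have hx' : 1 / 2 ≤ x := hx
  have h := g_sub x y
  have : 0 < (y - x) * (4 * (y ^ 2 + x * y + x ^ 2) - 4 * (x + y) + 1) := by
    apply mul_pos (by linarith)
    nlinarith [mul_nonneg (sub_nonneg.2 hx') (sub_nonneg.2 (hx'.trans hxy.le)),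
      mul_nonneg (sub_nonneg.2 hx') (sub_nonneg.2 hx'), mul_pos (sub_pos.2 hxy) (sub_pos.2 hxy)]
  linarith

theorem g_half : g (1 / 2) = 0 := by norm_num [g]

theorem g_one : g 1 = 1 := by norm_num [g]

theorem continuous_g : Continuous g := by unfold g; fun_prop

theorem g_bijOn : Set.BijOn g (Set.Icc (1 / 2) 1) (Set.Icc 0 1) := by
  have hm : StrictMonoOn g (Set.Icc (1 / 2) 1) := g_strictMonoOn.mono Set.Icc_subset_Ici_self
  refine ⟨fun x hx => ⟨?_, ?_⟩, hm.injOn, ?_⟩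
  · rw [← g_half]; exact hm.monotoneOn ⟨le_rfl, by norm_num⟩ hx hx.1
  · rw [← g_one]; exact hm.monotoneOn hx ⟨by norm_num, le_rfl⟩ hx.2
  · have := intermediate_value_Icc (by norm_num : (1 / 2 : ℝ) ≤ 1) continuous_g.continuousOn
    rwa [g_half, g_one] at this

/-- Cardano's substitution `x = (2 + w + w⁻¹) / 6` turns `g x` into `(w³ + w⁻³ + 2) / 54`. So `t =
w³` has to solve `t + t⁻¹ = 54 z - 2`, a quadratic whose root `t ≥ 1` is real exactly when `z ≥
2/27` (among positive `z`). -/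
theorem f_spec {z : ℝ} (hz : z ∈ Set.Icc (2 / 27 : ℝ) 1) :
    f z ∈ Set.Icc (1 / 2 : ℝ) 1 ∧ g (f z) = z := by
  obtain ⟨h0, h1⟩ := hz
  set t : ℝ := 3 * √3 * √(27 * z ^ 2 - 2 * z) + 27 * z - 1 with ht
  set w : ℝ := t ^ (1 / 3 : ℝ) with hw
  have hs : 0 ≤ 27 * z ^ 2 - 2 * z := by nlinarith
  have hr : (3 * √3 * √(27 * z ^ 2 - 2 * z)) ^ 2 = 27 * (27 * z ^ 2 - 2 * z) := by
    rw [mul_pow, mul_pow, Real.sq_sqrt hs, Real.sq_sqrt (by norm_num)]; ring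
  have hr0 : 0 ≤ 3 * √3 * √(27 * z ^ 2 - 2 * z) := by positivity
  have ht1 : 1 ≤ t := by rw [ht]; linarith
  have ht2 : t ^ 2 - (54 * z - 2) * t + 1 = 0 := by
    rw [ht]; linear_combination hr
  have hw0 : 0 < w := Real.rpow_pos_of_pos (by linarith) _
  have hw3 : w ^ 3 = t := by
    rw [hw, ← Real.rpow_natCast, ← Real.rpow_mul (by linarith)]; norm_num
  have hf : f z = (2 + (w + w⁻¹)) / 6 := by
    have : t ^ (-(1 / 3) : ℝ) = w⁻¹ := Real.rpow_neg (by linarith) _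
    unfold f
    rw [← ht, this, ← hw]; ring
  have hu : 2 ≤ w + w⁻¹ := by
    have : w + w⁻¹ - 2 = (w - 1) ^ 2 / w := by field_simp; ring
    have : 0 ≤ (w - 1) ^ 2 / w := by positivity
    linarith
  have hg : g (f z) = z := by
    rw [hf]
    have e : g ((2 + (w + w⁻¹)) / 6) = (w ^ 3 + (w ^ 3)⁻¹ + 2) / 54 := by
      unfold g; field_simp; ring
    rw [e, hw3]
    have : 0 < t := by linarith
    field_simp
    linear_combination ht2
  have hlow : 1 / 2 ≤ f z := by rw [hf]; linarith
  refine ⟨⟨hlow, ?_⟩, hg⟩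
  by_contra! h
  have := g_strictMonoOn (by norm_num : (1 : ℝ) ∈ Set.Ici (1 / 2)) hlow h
  rw [hg, g_one] at this
  linarith

/-- A number whose image under `g` is at most `z` is at most `f z`. -/
theorem le_f {x z : ℝ} (hz : z ∈ Set.Icc (2 / 27 : ℝ) 1) (hx : 1 / 2 ≤ x → g x ≤ z) :
    x ≤ f z := by
  obtain ⟨⟨hf, -⟩, hg⟩ := f_spec hz
  by_cases h : 1 / 2 ≤ x
  · rw [← hg] at hx
    exact (g_strictMonoOn.le_iff_le h hf).1 (hx h)
  · linarith

/-! ### The bound on the bias -/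

/-- With `c = biasBound + 1/2`, the equation `g (1 / (2c)) = c` reads `(1 - c)² = 2 c⁴`; this is its
square root `1 - c = √2 c²`. -/
theorem biasBound_quadratic : √2 * (biasBound + 1 / 2) ^ 2 + (biasBound + 1 / 2) = 1 := by
  have h2 : √2 ^ 2 = 2 := Real.sq_sqrt (by norm_num)
  have h2p : 0 < √2 := by positivity
  have hh : √(1 / 2) = √2 / 2 := by
    rw [Real.sqrt_eq_iff_mul_self_eq (by norm_num) (by positivity)]; linear_combination -h2 / 4
  have hs : √(1 / 2 + 2 * √2) ^ 2 = 1 / 2 + 2 * √2 := Real.sq_sqrt (by positivity)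
  unfold biasBound
  rw [hh]
  linear_combination √2 / 4 * hs + (√2 / 16 - √(1 / 2 + 2 * √2) / 4 + 1 / 2) * h2

theorem abs_biasBound_sub_lt : |biasBound - 0.0586| < 0.00005 := by
  have h2 : √2 ^ 2 = 2 := Real.sq_sqrt (by norm_num)
  have h2p : 0 < √2 := by positivity
  have hlo : 1.4142 < √2 := by rw [Real.lt_sqrt (by norm_num)]; norm_num
  have hhi : √2 < 1.414215 := by rw [Real.sqrt_lt' (by norm_num)]; norm_num
  have hh : √(1 / 2) = √2 / 2 := by
    rw [Real.sqrt_eq_iff_mul_self_eq (by norm_num) (by positivity)]; linear_combination -h2 / 4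
  have slo : 1.824383 < √(1 / 2 + 2 * √2) := by
    rw [Real.lt_sqrt (by norm_num)]; norm_num; linarith
  have shi : √(1 / 2 + 2 * √2) < 1.8244 := by
    rw [Real.sqrt_lt' (by norm_num)]; norm_num; linarith
  unfold biasBound
  rw [hh, abs_lt]
  constructor <;> norm_num <;> linarith

/-- The product bound implies the bound on the bias. -/
theorem biasBound_le_of_product {a b : ℝ} (hb : b ∈ Set.Icc (1 / 2 : ℝ) 1)
    (hab : 1 / 2 ≤ a * f b) : biasBound ≤ max (a - 1 / 2) (b - 1 / 2) := by
  by_contra! h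
  obtain ⟨ha, hbb⟩ := max_lt_iff.1 h
  have hq := biasBound_quadratic
  have habs := abs_lt.1 abs_biasBound_sub_lt
  set c := biasBound + 1 / 2 with hc
  have hc0 : 1 / 2 < c := by rw [hc]; norm_num at habs; linarith [habs.1]
  have hc1 : c < 1 := by rw [hc]; norm_num at habs; linarith [habs.2]
  -- This says `f c = 1 / (2c)`, so `c` is the balanced point of the product bound. Since `b < c`,
  -- strict monotonicity gives `f b < 1 / (2c)`.
  have hg : g (1 / (2 * c)) = c := by
    have h2 : √2 ^ 2 = 2 := Real.sq_sqrt (by norm_num)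
    unfold g
    field_simp
    linear_combination (-1 + c - √2 * c ^ 2) * hq + c ^ 4 * h2
  have hz : b ∈ Set.Icc (2 / 27 : ℝ) 1 := ⟨by linarith [hb.1], hb.2⟩
  obtain ⟨⟨hf, -⟩, hgf⟩ := f_spec hz
  have hlt : f b < 1 / (2 * c) := by
    rw [← g_strictMonoOn.lt_iff_lt hf, hg, hgf]
    · linarith
    · show 1 / 2 ≤ 1 / (2 * c)
      rw [div_le_div_iff₀] <;> linarith
  have h1 : a * f b ≤ c * f b := mul_le_mul_of_nonneg_right (by linarith) (by linarith)
  have h2 : c * f b < c * (1 / (2 * c)) := mul_lt_mul_of_pos_left hlt (by linarith)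
  have h3 : c * (1 / (2 * c)) = 1 / 2 := by field_simp
  linarith

/-! ### Effects and their probabilities -/

section Prob

variable {H J L : Type} [Fintype H] [Fintype J] [Fintype L]

theorem prob_add (ψ : H → ℂ) (E F : Matrix H H ℂ) : prob ψ (E + F) = prob ψ E + prob ψ F := by
  simp [prob, Matrix.add_mulVec]

theorem prob_sub (ψ : H → ℂ) (E F : Matrix H H ℂ) : prob ψ (E - F) = prob ψ E - prob ψ F := by
  simp [prob, Matrix.sub_mulVec]

theorem prob_zero (ψ : H → ℂ) : prob ψ (0 : Matrix H H ℂ) = 0 := by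
  simp [prob]

theorem prob_sum {ι : Type} (s : Finset ι) (ψ : H → ℂ) (E : ι → Matrix H H ℂ) :
    prob ψ (∑ i ∈ s, E i) = ∑ i ∈ s, prob ψ (E i) := by
  classical
  induction s using Finset.induction_on with
  | empty => simp [prob_zero]
  | insert a s ha ih => simp [Finset.sum_insert ha, prob_add, ih]

theorem prob_smul (r : ℝ) (ψ : H → ℂ) (E : Matrix H H ℂ) : prob ψ (r • E) = r * prob ψ E := by
  simp [prob, Matrix.smul_mulVec]

theorem prob_nonneg (ψ : H → ℂ) {E : Matrix H H ℂ} (hE : E.PosSemidef) : 0 ≤ prob ψ E :=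
  hE.re_dotProduct_nonneg ψ

theorem prob_mono (ψ : H → ℂ) {E F : Matrix H H ℂ} (h : (F - E).PosSemidef) :
    prob ψ E ≤ prob ψ F := by
  have := prob_nonneg ψ h
  rw [prob_sub] at this
  linarith

theorem prob_mulVec (X : Matrix J H ℂ) (ψ : H → ℂ) (E : Matrix J J ℂ) :
    prob (X *ᵥ ψ) E = prob ψ (Xᴴ * E * X) := by
  unfold prob
  rw [Matrix.star_mulVec, ← Matrix.dotProduct_mulVec, Matrix.mulVec_mulVec, Matrix.mulVec_mulVec,
    Matrix.mul_assoc]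

theorem prob_submatrix (e : J ≃ H) (ψ : J → ℂ) (E : Matrix H H ℂ) :
    prob ψ (E.submatrix e e) = prob (ψ ∘ e.symm) E := by
  unfold prob
  rw [Matrix.submatrix_mulVec_equiv]
  unfold dotProduct
  rw [← e.sum_comp]
  simp

theorem prob_one [DecidableEq H] (ψ : H → ℂ) : prob ψ 1 = ∑ h, ‖ψ h‖ ^ 2 := by
  simp only [prob, Matrix.one_mulVec, dotProduct, Complex.re_sum]
  refine Finset.sum_congr rfl fun h _ => ?_
  rw [Pi.star_apply, Complex.star_def, ← Complex.normSq_eq_conj_mul_self, Complex.ofReal_re,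
    Complex.normSq_eq_norm_sq]

end Prob

/-! ### Kronecker products acting on vectors, factorisation of positive matrices, and unitary
freedom. -/

section Linear

variable {H J L J' L' : Type} [Fintype H] [Fintype J] [Fintype L] 

theorem kronecker_mulVec_apply (F : Matrix J' J ℂ) (G : Matrix L' L ℂ) (ψ : J × L → ℂ) (p : J' × L') :
    ((F ⊗ₖ G) *ᵥ ψ) p = ∑ j, ∑ l, F p.1 j * G p.2 l * ψ (j, l) := by
  simp [Matrix.mulVec, dotProduct, Fintype.sum_prod_type]

theorem one_kronecker_mulVec_apply [DecidableEq J] (G : Matrix L' L ℂ) (ψ : J × L → ℂ) (p : J × L') :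
    (((1 : Matrix J J ℂ) ⊗ₖ G) *ᵥ ψ) p = ∑ l, G p.2 l * ψ (p.1, l) := by
  rw [kronecker_mulVec_apply, Finset.sum_eq_single p.1]
  · simp
  · intro j _ hj; simp [Matrix.one_apply_ne' hj]
  · simp

theorem kronecker_one_mulVec_apply [DecidableEq L] (F : Matrix J' J ℂ) (ψ : J × L → ℂ) (p : J' × L) :
    ((F ⊗ₖ (1 : Matrix L L ℂ)) *ᵥ ψ) p = ∑ j, F p.1 j * ψ (j, p.2) := by
  rw [kronecker_mulVec_apply]
  refine Finset.sum_congr rfl fun j _ => ?_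
  rw [Finset.sum_eq_single p.2]
  · simp
  · intro l _ hl; simp [Matrix.one_apply_ne' hl]
  · simp

theorem exists_eq_conjTranspose_mul_self {A : Matrix H H ℂ} (h : A.PosSemidef) :
    ∃ R : Matrix H H ℂ, A = Rᴴ * R := by
  classical
  open scoped MatrixOrder in
  exact CStarAlgebra.nonneg_iff_eq_star_mul_self.1 (Matrix.nonneg_iff_posSemidef.2 h)

theorem exists_eq_mul_conjTranspose_self {A : Matrix H H ℂ} (h : A.PosSemidef) :
    ∃ R : Matrix H H ℂ, A = R * Rᴴ := by
  obtain ⟨R, hR⟩ := exists_eq_conjTranspose_mul_self h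
  exact ⟨Rᴴ, by simpa using hR⟩

/-- Two matrices with the same Gram matrix of columns differ by a unitary on the left. -/
theorem exists_unitary_mul_eq [DecidableEq J] {X Y : Matrix J L ℂ} (h : Xᴴ * X = Yᴴ * Y) :
    ∃ U : Matrix.unitaryGroup J ℂ, (U : Matrix J J ℂ) * X = Y := by
  classical
  set f := Matrix.toEuclideanLin X
  set k := Matrix.toEuclideanLin Y
  have hin : ∀ (Z : Matrix J L ℂ) (v w : EuclideanSpace ℂ L),
      inner ℂ (Matrix.toEuclideanLin Z v) (Matrix.toEuclideanLin Z w)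
        = star v.ofLp ⬝ᵥ ((Zᴴ * Z) *ᵥ w.ofLp) := by
    intro Z v w
    rw [EuclideanSpace.inner_eq_star_dotProduct, dotProduct_comm]
    simp only [Matrix.toLpLin_apply]
    rw [Matrix.star_mulVec, ← Matrix.dotProduct_mulVec, Matrix.mulVec_mulVec]
  have hnorm : ∀ v, ‖f v‖ = ‖k v‖ := by
    intro v
    have : (inner ℂ (f v) (f v) : ℂ) = inner ℂ (k v) (k v) := by rw [hin, hin, h]
    rw [inner_self_eq_norm_sq_to_K, inner_self_eq_norm_sq_to_K] at this
    have h2 : ‖f v‖ ^ 2 = ‖k v‖ ^ 2 := by exact_mod_cast this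
    exact (sq_eq_sq₀ (norm_nonneg _) (norm_nonneg _)).1 h2
  -- Equal Gram matrices make `f v ↦ k v` a well-defined isometry on the range of `f`. It is written
  -- as `k ∘ s` with a linear section `s` of `f`, and then extended to the whole space.
  obtain ⟨s, hs⟩ := f.rangeRestrict.exists_rightInverse_of_surjective f.range_rangeRestrict
  have hs' : ∀ v : LinearMap.range f, f (s v) = v := fun v =>
    congrArg Subtype.val (LinearMap.congr_fun hs v)
  let T : LinearMap.range f →ₗᵢ[ℂ] EuclideanSpace ℂ J :=
    ⟨k ∘ₗ s, fun v => by
      rw [LinearMap.comp_apply, ← hnorm, hs']; rfl⟩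
  have hT : ∀ v, T.extend (f v) = k v := by
    intro v
    have e1 : T.extend ((⟨f v, LinearMap.mem_range_self f v⟩ : LinearMap.range f) : EuclideanSpace ℂ J)
        = T ⟨f v, LinearMap.mem_range_self f v⟩ := LinearIsometry.extend_apply T _
    refine e1.trans ?_
    show k (s _) = k v
    -- The vectors `s (f v)` and `v` differ by an element of the kernel of `f`, which by `hnorm` is
    -- also killed by `k`.
    rw [← sub_eq_zero, ← map_sub, ← norm_eq_zero, ← hnorm, map_sub, hs', sub_self, norm_zero]
  set U : Matrix J J ℂ := Matrix.toEuclideanLin.symm T.extend.toLinearMap with hU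
  have hUT : Matrix.toEuclideanLin U = T.extend.toLinearMap := by simp [hU]
  refine ⟨⟨U, Matrix.mem_unitaryGroup_iff'.2 ?_⟩, ?_⟩
  · ext i j
    have hij := T.extend.inner_map_map (EuclideanSpace.single i 1) (EuclideanSpace.single j 1)
    have e2 : ∀ v, T.extend v = Matrix.toEuclideanLin U v := fun v => by rw [hUT]; rfl
    rw [e2, e2, EuclideanSpace.inner_eq_star_dotProduct, dotProduct_comm] at hij
    simp only [Matrix.toLpLin_apply] at hij
    rw [Matrix.star_mulVec, ← Matrix.dotProduct_mulVec, Matrix.mulVec_mulVec] at hij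
    rw [EuclideanSpace.inner_single_left] at hij
    simpa [Matrix.one_apply, Pi.single_apply, dotProduct, Matrix.star_eq_conjTranspose] using hij
  · apply Matrix.toEuclideanLin.injective
    ext v : 1
    have := hT v
    have e2 : ∀ v, T.extend v = Matrix.toEuclideanLin U v := fun v => by rw [hUT]; rfl
    rw [e2] at this
    rw [← this]
    simp [f, Matrix.toLpLin_apply, Matrix.mulVec_mulVec]

end Linear

/-! ### Reduced states -/

section Reduced

variable {J L : Type} [Fintype J]

/-- The reduced state on the second factor. -/
def red (ψ : J × L → ℂ) : Matrix L L ℂ :=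
  Matrix.of fun l l' => ∑ j, ψ (j, l) * star (ψ (j, l'))

theorem red_apply (ψ : J × L → ℂ) (l l' : L) : red ψ l l' = ∑ j, ψ (j, l) * star (ψ (j, l')) := rfl

theorem red_eq (ψ : J × L → ℂ) :
    red ψ = (Matrix.of fun l j => ψ (j, l)) * (Matrix.of fun l j => ψ (j, l))ᴴ := by
  ext l l'
  simp [red_apply, Matrix.mul_apply]

variable [Fintype L]

theorem red_posSemidef (ψ : J × L → ℂ) : (red ψ).PosSemidef := by
  rw [red_eq]
  exact Matrix.posSemidef_self_mul_conjTranspose _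

theorem red_one_kronecker_mulVec [DecidableEq J] (V : Matrix L L ℂ) (ψ : J × L → ℂ) :
    red (((1 : Matrix J J ℂ) ⊗ₖ V) *ᵥ ψ) = V * red ψ * Vᴴ := by
  have : (Matrix.of fun l j => (((1 : Matrix J J ℂ) ⊗ₖ V) *ᵥ ψ) (j, l))
      = V * (Matrix.of fun l j => ψ (j, l)) := by
    ext l j
    simp [one_kronecker_mulVec_apply, Matrix.mul_apply]
  rw [red_eq, red_eq, this, Matrix.conjTranspose_mul]
  simp only [Matrix.mul_assoc]

/-- The probability of an effect on the second factor. -/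
theorem prob_one_kronecker [DecidableEq J] (ψ : J × L → ℂ) (E : Matrix L L ℂ) :
    prob ψ ((1 : Matrix J J ℂ) ⊗ₖ E) = (E * red ψ).trace.re := by
  unfold prob
  congr 1
  simp only [dotProduct, one_kronecker_mulVec_apply, Matrix.trace, Matrix.diag, Matrix.mul_apply,
    red_apply, Fintype.sum_prod_type, Finset.mul_sum, Pi.star_apply]
  rw [Finset.sum_comm]
  refine Finset.sum_congr rfl fun l _ => ?_
  rw [Finset.sum_comm]
  refine Finset.sum_congr rfl fun l' _ => Finset.sum_congr rfl fun j _ => ?_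
  ring

/-- Two vectors with the same reduced state differ by a unitary on the other factor. -/
theorem exists_unitary_kronecker_mulVec_eq [DecidableEq J] [DecidableEq L] {ψ φ : J × L → ℂ}
    (h : red ψ = red φ) :
    ∃ U : Matrix.unitaryGroup J ℂ, ((U : Matrix J J ℂ) ⊗ₖ (1 : Matrix L L ℂ)) *ᵥ ψ = φ := by
  obtain ⟨U, hU⟩ := exists_unitary_mul_eq (X := Matrix.of fun j l => ψ (j, l))
    (Y := Matrix.of fun j l => φ (j, l)) (by
      ext l l'
      have := congrFun (congrFun h l') l
      simpa [red_apply, Matrix.mul_apply, mul_comm] using this)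
  refine ⟨U, funext fun p => ?_⟩
  have := congrFun (congrFun hU p.1) p.2
  simpa [kronecker_one_mulVec_apply, Matrix.mul_apply] using this

/-- A projective measurement with outcomes in `O`. -/
structure POVM.IsProjective {O H : Type} [Fintype O] [Fintype H] [DecidableEq H] (E : POVM O H) :
    Prop where
  mul_self : ∀ o, E.op o * E.op o = E.op o

/-- Any decomposition of the reduced state of a vector on `J × L` can be produced by a projective
measurement on `J`, provided `J` is large enough. -/
theorem exists_povm_of_red_eq_sum [DecidableEq J] [DecidableEq L] {O : Type} [Fintype O]
    [DecidableEq O] [Nonempty O] {ι : O × L → J} (hι : Function.Injective ι) {ψ : J × L → ℂ}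
    {τ : O → Matrix L L ℂ} (hτ : ∀ o, (τ o).PosSemidef) (h : red ψ = ∑ o, τ o) :
    ∃ E : POVM O J, E.IsProjective ∧
      ∀ o (X : Matrix L L ℂ), prob ψ (E.op o ⊗ₖ X) = (X * τ o).trace.re := by
  choose R hR using fun o => exists_eq_mul_conjTranspose_self (hτ o)
  obtain ⟨lab, hlab⟩ : ∃ lab : J → O, ∀ p, lab (ι p) = p.1 :=
    ⟨Function.extend ι Prod.fst fun _ => Classical.arbitrary O, hι.extend_apply _ _⟩
  -- A purification of `∑ o, τ o` in which the label `o` is visible in `J`: the block labelled `o`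
  -- purifies `τ o`. Where `lab` takes its default value `φ` vanishes, so that default is harmless.
  -- The measurement is the readout of the label, conjugated by the unitary that carries `ψ` to `φ`;
  -- being a readout, it is projective.
  let φ : J × L → ℂ := fun q => ∑ p : O × L, if ι p = q.1 then R p.1 q.2 p.2 else 0
  have hφ : ∀ p l, φ (ι p, l) = R p.1 l p.2 := by
    intro p l
    simp only [φ]
    rw [Finset.sum_eq_single p]
    · simp
    · intro q _ hq; simp [hι.ne hq]
    · simp
  have hφ0 : ∀ j l, (∀ p, ι p ≠ j) → φ (j, l) = 0 := by
    intro j l hj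
    simp [φ, hj]
  let D : O → Matrix J J ℂ := fun o => Matrix.diagonal fun j => if lab j = o then 1 else 0
  have hDφ : ∀ o, red ((D o ⊗ₖ (1 : Matrix L L ℂ)) *ᵥ φ) = τ o := by
    intro o
    have happ : ∀ j l, ((D o ⊗ₖ (1 : Matrix L L ℂ)) *ᵥ φ) (j, l)
        = if lab j = o then φ (j, l) else 0 := by
      intro j l
      rw [kronecker_one_mulVec_apply]
      simp [D, Matrix.diagonal_apply]
    ext l l'
    rw [red_apply]
    simp only [happ]
    rw [hR o, Matrix.mul_apply]
    have hinj : Function.Injective fun k : L => ι (o, k) := fun a b hab => by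
      simpa using hι hab
    rw [← Finset.sum_subset (Finset.subset_univ (Finset.univ.map ⟨_, hinj⟩)), Finset.sum_map]
    · refine Finset.sum_congr rfl fun k _ => ?_
      simp [hlab, hφ]
    · intro j _ hj
      by_cases hlj : lab j = o
      · rw [if_pos hlj, hφ0 j l, zero_mul]
        rintro ⟨o', k⟩ rfl
        apply hj
        rw [hlab] at hlj
        simp at hlj
        subst hlj
        simp
      · simp [hlj]
  have hDsum : ∑ o, D o = 1 := by
    ext i j
    rw [Matrix.sum_apply]
    by_cases hij : i = j
    · subst hij; simp [D]
    · simp [D, hij]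
  have hDD : ∀ o, D o * D o = D o := by
    intro o
    simp [D, Matrix.diagonal_mul_diagonal]
  have hDH : ∀ o, (D o)ᴴ = D o := by
    intro o
    simp only [D, Matrix.diagonal_conjTranspose]
    congr 1
    ext j
    simp only [Pi.star_apply]
    split_ifs <;> simp
  have hredφ : red ψ = red φ := by
    have hφD : red φ = ∑ o, red ((D o ⊗ₖ (1 : Matrix L L ℂ)) *ᵥ φ) := by
      ext l l'
      simp only [Matrix.sum_apply, red_apply, kronecker_one_mulVec_apply]
      rw [Finset.sum_comm]
      refine Finset.sum_congr rfl fun j _ => ?_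
      simp [D, Matrix.diagonal_apply, ite_mul]
    rw [h, hφD]
    exact Finset.sum_congr rfl fun o _ => (hDφ o).symm
  obtain ⟨U, hU⟩ := exists_unitary_kronecker_mulVec_eq hredφ
  set W : Matrix J J ℂ := (U : Matrix J J ℂ) with hW
  have hUU : Wᴴ * W = 1 := Matrix.mem_unitaryGroup_iff'.1 U.2
  have hUU' : W * Wᴴ = 1 := Matrix.mem_unitaryGroup_iff.1 U.2
  have hsq : ∀ o, Wᴴ * D o * W = (D o * W)ᴴ * (D o * W) := by
    intro o
    rw [Matrix.conjTranspose_mul, hDH, Matrix.mul_assoc, Matrix.mul_assoc, ← Matrix.mul_assoc (D o),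
      hDD]
  refine ⟨⟨fun o => Wᴴ * D o * W, fun o => ?_, ?_⟩, ⟨fun o => ?_⟩, fun o X => ?_⟩
  · rw [hsq]
    exact Matrix.posSemidef_conjTranspose_mul_self _
  · rw [← Finset.sum_mul, ← Finset.mul_sum, hDsum, Matrix.mul_one, hUU]
  · calc Wᴴ * D o * W * (Wᴴ * D o * W) = Wᴴ * D o * (W * Wᴴ) * D o * W := by
          simp only [Matrix.mul_assoc]
      _ = Wᴴ * (D o * D o) * W := by rw [hUU', Matrix.mul_one]; simp only [Matrix.mul_assoc]
      _ = _ := by rw [hDD]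
  · have e : (Wᴴ * D o * W) ⊗ₖ X
        = ((D o * W) ⊗ₖ (1 : Matrix L L ℂ))ᴴ * ((1 : Matrix J J ℂ) ⊗ₖ X)
            * ((D o * W) ⊗ₖ (1 : Matrix L L ℂ)) := by
      rw [Matrix.conjTranspose_kronecker, ← Matrix.mul_kronecker_mul, ← Matrix.mul_kronecker_mul,
        hsq]
      simp
    show prob ψ ((Wᴴ * D o * W) ⊗ₖ X) = _
    rw [e, ← prob_mulVec, prob_one_kronecker]
    have : ((D o * W) ⊗ₖ (1 : Matrix L L ℂ)) *ᵥ ψ = (D o ⊗ₖ (1 : Matrix L L ℂ)) *ᵥ φ := by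
      rw [← hU, Matrix.mulVec_mulVec, ← Matrix.mul_kronecker_mul, Matrix.one_mul]
    rw [this, hDφ]

end Reduced

/-! ### Evolution from an arbitrary joint vector -/

section Evolve

variable {A M B : Type} [Fintype A] [DecidableEq A] [Fintype M] [DecidableEq M]
  [Fintype B] [DecidableEq B]

/-- The joint vector after `n` rounds, when it starts in `ψ₀`. -/
def evolve (U : ℕ → Matrix.unitaryGroup (A × M) ℂ) (V : ℕ → Matrix.unitaryGroup (M × B) ℂ)
    (ψ₀ : A × M × B → ℂ) : ℕ → (A × M × B → ℂ)
  | 0 => ψ₀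
  | n + 1 =>
      ((1 : Matrix A A ℂ) ⊗ₖ (V n : Matrix (M × B) (M × B) ℂ)) *ᵥ
        (tensorLeft (U n : Matrix (A × M) (A × M) ℂ) (1 : Matrix B B ℂ) *ᵥ evolve U V ψ₀ n)

theorem run_eq_evolve (U : ℕ → Matrix.unitaryGroup (A × M) ℂ)
    (V : ℕ → Matrix.unitaryGroup (M × B) ℂ) (a : A) (m : M) (b : B) (n : ℕ) :
    run U V a m b n = evolve U V (Pi.single (a, m, b) 1) n := by
  induction n with
  | zero => rfl
  | succ n ih => rw [run, ih, evolve]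

theorem evolve_congr {U U' : ℕ → Matrix.unitaryGroup (A × M) ℂ}
    {V V' : ℕ → Matrix.unitaryGroup (M × B) ℂ} (ψ₀ : A × M × B → ℂ) {n : ℕ}
    (hU : ∀ i < n, U i = U' i) (hV : ∀ i < n, V i = V' i) :
    evolve U V ψ₀ n = evolve U' V' ψ₀ n := by
  induction n with
  | zero => rfl
  | succ n ih =>
    rw [evolve, evolve, ih (fun i hi => hU i (by omega)) (fun i hi => hV i (by omega)),
      hU n (by omega), hV n (by omega)]

/-- A vector on `A ⊗ M ⊗ B` as a vector on `(A ⊗ M) ⊗ B`. -/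
def grp (ψ : A × M × B → ℂ) : (A × M) × B → ℂ := fun p => ψ (p.1.1, p.1.2, p.2)

theorem grp_injective : Function.Injective (grp : (A × M × B → ℂ) → _) := fun _ _ h =>
  funext fun p => congrFun h ((p.1, p.2.1), p.2.2)

theorem grp_tensorLeft_mulVec (X : Matrix (A × M) (A × M) ℂ) (Y : Matrix B B ℂ)
    (ψ : A × M × B → ℂ) : grp (tensorLeft X Y *ᵥ ψ) = (X ⊗ₖ Y) *ᵥ grp ψ := by
  unfold tensorLeft
  rw [Matrix.reindex_apply, Matrix.submatrix_mulVec_equiv]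
  rfl

theorem prob_tensorLeft (X : Matrix (A × M) (A × M) ℂ) (Y : Matrix B B ℂ) (ψ : A × M × B → ℂ) :
    prob ψ (tensorLeft X Y) = prob (grp ψ) (X ⊗ₖ Y) := by
  unfold tensorLeft
  rw [Matrix.reindex_apply, prob_submatrix]
  rfl

/-- The partial trace over the first factor. -/
def ptrace (ρ : Matrix (M × B) (M × B) ℂ) : Matrix B B ℂ :=
  Matrix.of fun b b' => ∑ m, ρ (m, b) (m, b')

theorem ptrace_red (ψ : A × M × B → ℂ) : ptrace (red ψ) = red (grp ψ) := by
  ext b b'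
  simp only [ptrace, Matrix.of_apply, red_apply, grp, Fintype.sum_prod_type]
  exact Finset.sum_comm

/-- Purification: for `ρ = R Rᴴ` the columns of `R` are placed at distinct basis states of `A`. -/
theorem exists_red_eq {L : Type} [Fintype L] {ι : L → A} (hι : Function.Injective ι)
    {ρ : Matrix L L ℂ} (hρ : ρ.PosSemidef) : ∃ φ : A × L → ℂ, red φ = ρ := by
  obtain ⟨R, rfl⟩ := exists_eq_mul_conjTranspose_self hρ
  let φ : A × L → ℂ := fun q => ∑ p, if ι p = q.1 then R q.2 p else 0
  have hφ : ∀ p l, φ (ι p, l) = R l p := by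
    intro p l
    simp only [φ]
    rw [Finset.sum_eq_single p]
    · simp
    · intro q _ hq; simp [hι.ne hq]
    · simp
  refine ⟨φ, ?_⟩
  ext l l'
  rw [red_apply, Matrix.mul_apply, ← Finset.sum_subset (Finset.subset_univ (Finset.univ.map ⟨ι, hι⟩)),
    Finset.sum_map]
  · simp [hφ]
  · intro j _ hj
    have : ∀ p, ι p ≠ j := fun p hp => hj (by simp [← hp])
    simp [φ, this]

/-- Alice can steer the joint state of `M ⊗ B` to any state with the present reduced state on
`B`. -/
theorem exists_unitary_red_eq {ι : M × B → A} (hι : Function.Injective ι) {ψ : A × M × B → ℂ}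
    {ρ : Matrix (M × B) (M × B) ℂ} (hρ : ρ.PosSemidef) (h : ptrace ρ = red (grp ψ)) :
    ∃ U : Matrix.unitaryGroup (A × M) ℂ,
      red (tensorLeft (U : Matrix (A × M) (A × M) ℂ) (1 : Matrix B B ℂ) *ᵥ ψ) = ρ := by
  obtain ⟨φ, rfl⟩ := exists_red_eq hι hρ
  rw [ptrace_red] at h
  obtain ⟨U, hU⟩ := exists_unitary_kronecker_mulVec_eq h.symm
  refine ⟨U, ?_⟩
  rw [grp_injective ((grp_tensorLeft_mulVec _ _ _).trans hU)]

/-- Every feasible sequence of states of `M ⊗ B` is realised by a strategy of Alice. -/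
theorem exists_strategy {ι : M × B → A} (hι : Function.Injective ι) (ψ₀ : A × M × B → ℂ)
    (V : ℕ → Matrix.unitaryGroup (M × B) ℂ) {ρ : ℕ → Matrix (M × B) (M × B) ℂ}
    {s : ℕ → Matrix B B ℂ} (n : ℕ) (hρ : ∀ i < n, (ρ i).PosSemidef) (hs0 : s 0 = red (grp ψ₀))
    (hin : ∀ i < n, ptrace (ρ i) = s i)
    (hout : ∀ i < n, s (i + 1) = ptrace ((V i : Matrix (M × B) (M × B) ℂ) * ρ i
      * (V i : Matrix (M × B) (M × B) ℂ)ᴴ)) :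
    ∃ U : ℕ → Matrix.unitaryGroup (A × M) ℂ, red (grp (evolve U V ψ₀ n)) = s n := by
  induction n with
  | zero => exact ⟨fun _ => 1, hs0.symm⟩
  | succ n ih =>
    obtain ⟨U, hU⟩ := ih (fun i hi => hρ i (by omega)) (fun i hi => hin i (by omega))
      (fun i hi => hout i (by omega))
    obtain ⟨W, hW⟩ := exists_unitary_red_eq hι (ψ := evolve U V ψ₀ n) (hρ n (by omega))
      ((hin n (by omega)).trans hU.symm)
    refine ⟨Function.update U n W, ?_⟩
    rw [evolve, ← ptrace_red, red_one_kronecker_mulVec, hout n (by omega), Function.update_self,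
      evolve_congr (U' := U) (V' := V) ψ₀ (fun i hi => Function.update_of_ne (by omega) _ _)
        (fun _ _ => rfl), hW]

theorem tensorLeft_conjTranspose (X : Matrix (A × M) (A × M) ℂ) (Y : Matrix B B ℂ) :
    (tensorLeft X Y)ᴴ = tensorLeft Xᴴ Yᴴ := by
  unfold tensorLeft
  rw [← Matrix.conjTranspose_kronecker]
  rfl

theorem tensorLeft_mul (X X' : Matrix (A × M) (A × M) ℂ) (Y Y' : Matrix B B ℂ) :
    tensorLeft X Y * tensorLeft X' Y' = tensorLeft (X * X') (Y * Y') := by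
  unfold tensorLeft
  rw [Matrix.mul_kronecker_mul, Matrix.reindex_apply, Matrix.reindex_apply,
    Matrix.submatrix_mul_equiv]
  rfl

theorem tensorLeft_one : tensorLeft (1 : Matrix (A × M) (A × M) ℂ) (1 : Matrix B B ℂ) = 1 := by
  simp [tensorLeft]

theorem tensorLeft_kronecker (X : Matrix A A ℂ) (Y : Matrix M M ℂ) (Z : Matrix B B ℂ) :
    tensorLeft (X ⊗ₖ Y) Z = X ⊗ₖ (Y ⊗ₖ Z) :=
  Matrix.kronecker_assoc X Y Z

theorem tensorLeft_posSemidef {X : Matrix (A × M) (A × M) ℂ} {Y : Matrix B B ℂ}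
    (hX : X.PosSemidef) (hY : Y.PosSemidef) : (tensorLeft X Y).PosSemidef :=
  (hX.kronecker hY).submatrix _

theorem prob_unitary {H : Type} [Fintype H] [DecidableEq H] {X : Matrix H H ℂ} (hX : Xᴴ * X = 1)
    (ψ : H → ℂ) : prob (X *ᵥ ψ) 1 = prob ψ 1 := by
  rw [prob_mulVec, Matrix.mul_one, hX]

theorem prob_evolve_one (U : ℕ → Matrix.unitaryGroup (A × M) ℂ)
    (V : ℕ → Matrix.unitaryGroup (M × B) ℂ) (ψ₀ : A × M × B → ℂ) (n : ℕ) :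
    prob (evolve U V ψ₀ n) 1 = prob ψ₀ 1 := by
  induction n with
  | zero => rfl
  | succ n ih =>
    have hU : (U n : Matrix (A × M) (A × M) ℂ)ᴴ * (U n : Matrix (A × M) (A × M) ℂ) = 1 :=
      Matrix.mem_unitaryGroup_iff'.1 (U n).2
    have hV : (V n : Matrix (M × B) (M × B) ℂ)ᴴ * (V n : Matrix (M × B) (M × B) ℂ) = 1 :=
      Matrix.mem_unitaryGroup_iff'.1 (V n).2
    rw [evolve, prob_unitary, prob_unitary, ih]
    · rw [tensorLeft_conjTranspose, tensorLeft_mul, hU]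
      simp [tensorLeft_one]
    · rw [Matrix.conjTranspose_kronecker, ← Matrix.mul_kronecker_mul, hV]
      simp

end Evolve

/-! ### Positive semidefinite matrices and the trace pairing -/

section TracePairing

variable {H M : Type} [Fintype H] [DecidableEq H] [Fintype M] [DecidableEq M]

theorem trace_mul_vecMulVec (Z : Matrix H H ℂ) (v : H → ℂ) :
    (Z * Matrix.vecMulVec v (star v)).trace = star v ⬝ᵥ (Z *ᵥ v) := by
  rw [Matrix.mul_vecMulVec, Matrix.trace_vecMulVec, dotProduct_comm]

/-- The positive semidefinite cone is self-dual; rank one matrices suffice as tests. -/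
theorem posSemidef_of_trace_nonneg {Z : Matrix H H ℂ} (hZ : Z.IsHermitian)
    (h : ∀ X : Matrix H H ℂ, X.PosSemidef → 0 ≤ (Z * X).trace.re) : Z.PosSemidef := by
  refine Matrix.PosSemidef.of_dotProduct_mulVec_nonneg hZ fun v => ?_
  have h1 := h _ (Matrix.posSemidef_vecMulVec_self_star v)
  rw [trace_mul_vecMulVec] at h1
  rw [Complex.nonneg_iff]
  exact ⟨h1, (hZ.im_star_dotProduct_mulVec_self v).symm⟩

theorem ptrace_add (ρ ρ' : Matrix (M × H) (M × H) ℂ) : ptrace (ρ + ρ') = ptrace ρ + ptrace ρ' := by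
  ext b b'
  simp [ptrace, Finset.sum_add_distrib]

theorem ptrace_smul (r : ℝ) (ρ : Matrix (M × H) (M × H) ℂ) : ptrace (r • ρ) = r • ptrace ρ := by
  ext b b'
  simp [ptrace, Finset.mul_sum]

theorem ptrace_isHermitian {ρ : Matrix (M × H) (M × H) ℂ} (h : ρ.IsHermitian) :
    (ptrace ρ).IsHermitian := by
  ext b b'
  simp only [ptrace, Matrix.conjTranspose_apply, Matrix.of_apply, star_sum]
  exact Finset.sum_congr rfl fun m _ => h.apply _ _

/-- The partial trace is adjoint to `Z ↦ 1 ⊗ Z`; this is where the operators `1 ⊗ Z i` of the dual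
program come from. -/
theorem trace_mul_ptrace (Z : Matrix H H ℂ) (ρ : Matrix (M × H) (M × H) ℂ) :
    (Z * ptrace ρ).trace = (((1 : Matrix M M ℂ) ⊗ₖ Z) * ρ).trace := by
  have h : ∀ m h, ∑ p : M × H, ((1 : Matrix M M ℂ) ⊗ₖ Z) (m, h) p * ρ p (m, h)
      = ∑ h', Z h h' * ρ (m, h') (m, h) := by
    intro m h
    rw [Fintype.sum_prod_type, Finset.sum_eq_single m]
    · simp
    · intro m' _ hm; simp [Matrix.one_apply_ne' hm]
    · simp
  simp only [Matrix.trace, Matrix.diag, Matrix.mul_apply]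
  rw [Fintype.sum_prod_type]
  simp only [h, ptrace, Matrix.of_apply, Finset.mul_sum]
  rw [Finset.sum_comm]
  conv_rhs => rw [Finset.sum_comm]
  rw [Finset.sum_comm]
  exact Finset.sum_congr rfl fun h _ => Finset.sum_comm

theorem trace_ptrace (ρ : Matrix (M × H) (M × H) ℂ) : (ptrace ρ).trace = ρ.trace := by
  have := trace_mul_ptrace 1 ρ
  simpa using this

theorem trace_conj_unitary {V : Matrix H H ℂ} (hV : Vᴴ * V = 1) (ρ : Matrix H H ℂ) :
    (V * ρ * Vᴴ).trace = ρ.trace := by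
  rw [Matrix.trace_mul_comm, ← Matrix.mul_assoc, hV, Matrix.one_mul]

/-- For `ρ = Rᴴ R` the entry is an inner product of two columns of `R`, and the squared norm of each
column is at most the trace. It makes the trace control the norm in the compactness argument. -/
theorem norm_apply_le_trace {ρ : Matrix H H ℂ} (h : ρ.PosSemidef) (i j : H) :
    ‖ρ i j‖ ≤ ρ.trace.re := by
  obtain ⟨R, rfl⟩ := exists_eq_conjTranspose_mul_self h
  have htr : (Rᴴ * R).trace.re = ∑ k, ∑ l, ‖R l k‖ ^ 2 := by
    simp only [Matrix.trace, Matrix.diag, Matrix.mul_apply, Complex.re_sum,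
      Matrix.conjTranspose_apply]
    refine Finset.sum_congr rfl fun k _ => Finset.sum_congr rfl fun l _ => ?_
    rw [Complex.star_def, ← Complex.normSq_eq_conj_mul_self, Complex.ofReal_re,
      Complex.normSq_eq_norm_sq]
  have hle : ∀ k, ∑ l, ‖R l k‖ ^ 2 ≤ ∑ k, ∑ l, ‖R l k‖ ^ 2 := fun k =>
    Finset.single_le_sum (f := fun k => ∑ l, ‖R l k‖ ^ 2)
      (fun k _ => Finset.sum_nonneg fun l _ => sq_nonneg _) (Finset.mem_univ k)
  rw [htr, Matrix.mul_apply]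
  calc ‖∑ l, Rᴴ i l * R l j‖ ≤ ∑ l, ‖Rᴴ i l * R l j‖ := norm_sum_le _ _
    _ ≤ ∑ l, (‖R l i‖ ^ 2 + ‖R l j‖ ^ 2) / 2 := by
        refine Finset.sum_le_sum fun l _ => ?_
        rw [norm_mul, Matrix.conjTranspose_apply, norm_star]
        nlinarith [sq_nonneg (‖R l i‖ - ‖R l j‖)]
    _ = (∑ l, ‖R l i‖ ^ 2 + ∑ l, ‖R l j‖ ^ 2) / 2 := by
        rw [← Finset.sum_div, Finset.sum_add_distrib]
    _ ≤ _ := by linarith [hle i, hle j]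

theorem isClosed_posSemidef : IsClosed {ρ : Matrix H H ℂ | ρ.PosSemidef} := by
  simp only [Matrix.posSemidef_iff_dotProduct_mulVec, Set.ofPred_and, Set.ofPred_forall]
  refine IsClosed.inter (isClosed_eq (by fun_prop) continuous_id) (isClosed_iInter fun v => ?_)
  exact isClosed_le continuous_const (by fun_prop)

/-- A real functional on matrices is represented on Hermitian matrices by a Hermitian matrix. -/
theorem exists_isHermitian_trace (z : Matrix H H ℂ →ₗ[ℝ] ℝ) :
    ∃ Z : Matrix H H ℂ, Z.IsHermitian ∧
      ∀ X : Matrix H H ℂ, X.IsHermitian → z X = (Z * X).trace.re := by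
  -- Chosen so that `Re (Y k j * x)` is the value of `z` at the matrix with the single entry `x` at
  -- `(j, k)`. Its Hermitian part has the same real pairing with Hermitian matrices.
  let Y : Matrix H H ℂ := Matrix.of fun k j =>
    (z (Matrix.single j k 1) : ℂ) - Complex.I * (z (Matrix.single j k Complex.I) : ℂ)
  have hY : ∀ X, z X = (Y * X).trace.re := by
    intro X
    have hs : ∀ j k, z (Matrix.single j k (X j k)) = (Y k j * X j k).re := by
      intro j k
      have : Matrix.single j k (X j k) = (X j k).re • Matrix.single j k (1 : ℂ)
          + (X j k).im • Matrix.single j k Complex.I := by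
        rw [Matrix.smul_single, Matrix.smul_single, ← Matrix.single_add]
        congr 1
        simp [Complex.re_add_im]
      rw [this, map_add, map_smul, map_smul]
      simp [Y]
      ring
    conv_lhs => rw [Matrix.matrix_eq_sum_single X]
    simp only [map_sum, hs, Matrix.trace, Matrix.diag, Matrix.mul_apply, Complex.re_sum]
    exact Finset.sum_comm
  refine ⟨(1 / 2 : ℝ) • (Y + Yᴴ), ?_, fun X hX => ?_⟩
  · ext i j
    simp [add_comm]
  · have : (Yᴴ * X).trace.re = (Y * X).trace.re := by
      have h1 : Yᴴ * X = (X * Y)ᴴ := by rw [Matrix.conjTranspose_mul, hX.eq]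
      rw [h1, Matrix.trace_conjTranspose, Matrix.trace_mul_comm]
      simp
    rw [hY, smul_mul_assoc, Matrix.trace_smul, Matrix.add_mul, Matrix.trace_add]
    simp [this]
    ring

end TracePairing

/-! ### Duality for the optimal cheating probability -/

section Duality

attribute [local instance] Matrix.normedAddCommGroup Matrix.normedSpace

variable {H M C O : Type} [Fintype H] [DecidableEq H] [Fintype M] [DecidableEq M]
  [Fintype C] [Fintype O] {n : ℕ}

/-- The reduced states of the honest party that result from the states `ρ i` in the rounds. -/
def incoming (V : Fin n → Matrix (M × H) (M × H) ℂ) (ρ : Fin n → Matrix (M × H) (M × H) ℂ) :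
    Fin (n + 1) → Matrix H H ℂ :=
  -- The entry `0` stands where the initial state would be: it keeps the constraints linear, and the
  -- initial state enters through `target` instead.
  Fin.cons 0 fun i => ptrace (V i * ρ i * (V i)ᴴ)

/-- The constraints on the states `ρ i` of `M ⊗ H` chosen by the cheater, and on the final
decompositions of the state of `H`. -/
def constraintMap (V : Fin n → Matrix (M × H) (M × H) ℂ) :
    ((Fin n → Matrix (M × H) (M × H) ℂ) × (C → O → Matrix H H ℂ)) →ₗ[ℝ]
      ((Fin n → Matrix H H ℂ) × (C → Matrix H H ℂ)) where
  toFun x := (fun i => ptrace (x.1 i) - incoming V x.1 i.castSucc,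
    fun c => ∑ o, x.2 c o - incoming V x.1 (Fin.last n))
  map_add' x y := by
    have h : incoming V (x + y).1 = incoming V x.1 + incoming V y.1 := by
      funext j
      refine Fin.cases ?_ (fun i => ?_) j
      · simp [incoming]
      · simp [incoming, Matrix.mul_add, Matrix.add_mul, ptrace_add]
    rw [h]
    ext : 1
    · funext i
      simp only [Prod.fst_add, Pi.add_apply, ptrace_add]
      abel
    · funext c
      simp only [Prod.snd_add, Pi.add_apply, Finset.sum_add_distrib]
      abel
  map_smul' r x := by
    have h : incoming V (r • x).1 = r • incoming V x.1 := by
      funext j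
      refine Fin.cases ?_ (fun i => ?_) j
      · simp [incoming]
      · simp [incoming, ptrace_smul]
    rw [h]
    ext : 1
    · funext i
      simp [ptrace_smul, smul_sub]
    · funext c
      simp [Finset.smul_sum, smul_sub]

/-- The winning probability as a functional of the final decompositions. -/
def payoff (E : C → O → Matrix H H ℂ) :
    ((Fin n → Matrix (M × H) (M × H) ℂ) × (C → O → Matrix H H ℂ)) →ₗ[ℝ] ℝ where
  toFun x := ∑ c, ∑ o, (E c o * x.2 c o).trace.re
  map_add' x y := by
    simp [Matrix.mul_add, Matrix.trace_add, Finset.sum_add_distrib]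
  map_smul' r x := by
    simp [Matrix.trace_smul, Finset.mul_sum]

/-- The cone of candidate solutions. -/
def psdCone (H M C O : Type) (n : ℕ) :
    Set ((Fin n → Matrix (M × H) (M × H) ℂ) × (C → O → Matrix H H ℂ)) :=
  {x | (∀ i, (x.1 i).PosSemidef) ∧ ∀ c o, (x.2 c o).PosSemidef}

theorem psdCone_add {x y} (hx : x ∈ psdCone H M C O n) (hy : y ∈ psdCone H M C O n) :
    x + y ∈ psdCone H M C O n :=
  ⟨fun i => (hx.1 i).add (hy.1 i), fun c o => (hx.2 c o).add (hy.2 c o)⟩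

theorem psdCone_smul {x} (hx : x ∈ psdCone H M C O n) {r : ℝ} (hr : 0 ≤ r) :
    r • x ∈ psdCone H M C O n :=
  ⟨fun i => (hx.1 i).smul hr, fun c o => (hx.2 c o).smul hr⟩

theorem psdCone_zero : 0 ∈ psdCone H M C O n :=
  ⟨fun _ => Matrix.PosSemidef.zero, fun _ _ => Matrix.PosSemidef.zero⟩

theorem isClosed_psdCone : IsClosed (psdCone H M C O n) := by
  have h1 : ∀ i, IsClosed {x : (Fin n → Matrix (M × H) (M × H) ℂ) × (C → O → Matrix H H ℂ) |
      (x.1 i).PosSemidef} := fun i => isClosed_posSemidef.preimage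
        (f := fun x : (Fin n → Matrix (M × H) (M × H) ℂ) × (C → O → Matrix H H ℂ) => x.1 i)
        (by fun_prop)
  have h2 : ∀ c o, IsClosed {x : (Fin n → Matrix (M × H) (M × H) ℂ) × (C → O → Matrix H H ℂ) |
      (x.2 c o).PosSemidef} := fun c o => isClosed_posSemidef.preimage
        (f := fun x : (Fin n → Matrix (M × H) (M × H) ℂ) × (C → O → Matrix H H ℂ) => x.2 c o)
        (by fun_prop)
  have : psdCone H M C O n = (⋂ i, {x | (x.1 i).PosSemidef}) ∩
      ⋂ c, ⋂ o, {x | (x.2 c o).PosSemidef} := by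
    ext x; simp [psdCone]
  rw [this]
  exact (isClosed_iInter h1).inter (isClosed_iInter fun c => isClosed_iInter (h2 c))

/-- Candidate solutions are bounded in terms of their constraint values. -/
theorem norm_le_of_constraintMap {V : Fin n → Matrix (M × H) (M × H) ℂ}
    (hV : ∀ i, (V i)ᴴ * V i = 1) {x} (hx : x ∈ psdCone H M C O n) {R : ℝ}
    (h1 : ∀ i, ((constraintMap V x).1 i).trace.re ≤ R)
    (h2 : ∀ c, ((constraintMap V x).2 c).trace.re ≤ R) (hR : 0 ≤ R) :
    ‖x‖ ≤ (n + 1) * R := by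
  -- Unitary conjugation and the partial trace preserve the trace, so it grows by at most `R` per
  -- round.
  have hin : ∀ j : Fin (n + 1), (incoming V x.1 j).trace.re ≤ j * R := by
    intro j
    induction j using Fin.induction with
    | zero => simp [incoming]
    | succ i ih =>
      have h := h1 i
      have e : (incoming V x.1 i.succ).trace = (x.1 i).trace := by
        simp [incoming, trace_ptrace, trace_conj_unitary (hV i)]
      simp only [constraintMap, LinearMap.coe_mk, AddHom.coe_mk, Matrix.trace_sub, trace_ptrace,
        Complex.sub_re] at h
      rw [e]
      simp only [Fin.val_castSucc, Fin.val_succ, Nat.cast_add, Nat.cast_one] at ih ⊢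
      linarith
  have hn : ∀ j : Fin (n + 1), (j : ℝ) * R ≤ n * R := fun j =>
    mul_le_mul_of_nonneg_right (by exact_mod_cast Nat.lt_succ_iff.1 j.2) hR
  have hb : 0 ≤ ((n : ℝ) + 1) * R := by positivity
  refine max_le ?_ ?_
  · refine (pi_norm_le_iff_of_nonneg hb).2 fun i => (Matrix.norm_le_iff hb).2 fun p q => ?_
    refine (norm_apply_le_trace (hx.1 i) p q).trans ?_
    have h := h1 i
    simp only [constraintMap, LinearMap.coe_mk, AddHom.coe_mk, Matrix.trace_sub, trace_ptrace,
        Complex.sub_re] at h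
    linarith [hin i.castSucc, hn i.castSucc]
  · refine (pi_norm_le_iff_of_nonneg hb).2 fun c => (pi_norm_le_iff_of_nonneg hb).2 fun o =>
      (Matrix.norm_le_iff hb).2 fun p q => ?_
    refine (norm_apply_le_trace (hx.2 c o) p q).trans ?_
    have h := h2 c
    simp only [constraintMap, LinearMap.coe_mk, AddHom.coe_mk, Matrix.trace_sub, Matrix.trace_sum,
        Complex.sub_re, Complex.re_sum] at h
    have hs : (x.2 c o).trace.re ≤ ∑ o, (x.2 c o).trace.re :=
      Finset.single_le_sum (f := fun o => (x.2 c o).trace.re)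
        (fun o _ => (Complex.nonneg_iff.1 (hx.2 c o).trace_nonneg).1) (Finset.mem_univ o)
    linarith [hin (Fin.last n), hn (Fin.last n)]

/-- The set of attainable constraint values together with the payoffs below the attained ones. -/
def hypograph (V : Fin n → Matrix (M × H) (M × H) ℂ) (E : C → O → Matrix H H ℂ) :
    Set (((Fin n → Matrix H H ℂ) × (C → Matrix H H ℂ)) × ℝ) :=
  {y | ∃ x ∈ psdCone H M C O n, constraintMap V x = y.1 ∧ y.2 ≤ payoff E x}

/-- A linear image of a closed cone need not be closed. Here convergent constraint values force
bounded candidates (`norm_le_of_constraintMap`), so a subsequence of the candidates converges. This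
closedness is what makes strong duality available without an interior point. -/
theorem isClosed_hypograph {V : Fin n → Matrix (M × H) (M × H) ℂ} (hV : ∀ i, (V i)ᴴ * V i = 1)
    (E : C → O → Matrix H H ℂ) : IsClosed (hypograph V E) := by
  have : FirstCountableTopology (Matrix H H ℂ) :=
    inferInstanceAs (FirstCountableTopology (H → H → ℂ))
  refine IsSeqClosed.isClosed fun y y₀ hy hlim => ?_
  choose x hx hxy hpay using hy
  have hlim1 : Filter.Tendsto (fun k => (y k).1) Filter.atTop (nhds y₀.1) :=
    (continuous_fst.tendsto _).comp hlim
  have hlim2 : Filter.Tendsto (fun k => (y k).2) Filter.atTop (nhds y₀.2) :=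
    (continuous_snd.tendsto _).comp hlim
  have hbd : ∀ φ : ((Fin n → Matrix H H ℂ) × (C → Matrix H H ℂ)) → ℝ, Continuous φ →
      ∃ R, ∀ k, φ (y k).1 ≤ R := fun φ hφ => by
    obtain ⟨R, hR⟩ := (((hφ.tendsto _).comp hlim1).bddAbove_range)
    exact ⟨R, fun k => hR ⟨k, rfl⟩⟩
  choose R1 hR1 using fun i : Fin n => hbd (fun w => (w.1 i).trace.re)
    (Complex.continuous_re.comp (Continuous.matrix_trace (by fun_prop)))
  choose R2 hR2 using fun c : C => hbd (fun w => (w.2 c).trace.re)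
    (Complex.continuous_re.comp (Continuous.matrix_trace (by fun_prop)))
  set R := ∑ i, |R1 i| + ∑ c, |R2 c| with hR
  have hR1' : ∀ i, R1 i ≤ R := fun i => by
    have a := Finset.single_le_sum (f := fun i => |R1 i|) (fun i _ => abs_nonneg _)
      (Finset.mem_univ i)
    have b : 0 ≤ ∑ c, |R2 c| := Finset.sum_nonneg fun c _ => abs_nonneg _
    have c := le_abs_self (R1 i)
    linarith
  have hR2' : ∀ c, R2 c ≤ R := fun c => by
    have a := Finset.single_le_sum (f := fun i => |R2 i|) (fun i _ => abs_nonneg _)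
      (Finset.mem_univ c)
    have b : 0 ≤ ∑ c, |R1 c| := Finset.sum_nonneg fun c _ => abs_nonneg _
    have c := le_abs_self (R2 c)
    linarith
  have hbound : ∀ k, x k ∈ Metric.closedBall 0 ((n + 1) * R) := fun k => by
    rw [mem_closedBall_zero_iff]
    refine norm_le_of_constraintMap hV (hx k) (fun i => ?_) (fun c => ?_) (by positivity)
    · rw [hxy k]; exact (hR1 i k).trans (hR1' i)
    · rw [hxy k]; exact (hR2 c k).trans (hR2' c)
  obtain ⟨x₀, -, φ, hφ, hxlim⟩ := tendsto_subseq_of_bounded Metric.isBounded_closedBall hbound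
  have hc1 : Continuous (constraintMap (C := C) (O := O) V) :=
    LinearMap.continuous_of_finiteDimensional _
  have hc2 : Continuous (payoff (n := n) (M := M) E) :=
    LinearMap.continuous_of_finiteDimensional _
  refine ⟨x₀, isClosed_psdCone.mem_of_tendsto hxlim (Filter.Eventually.of_forall fun k => hx _),
    ?_, ?_⟩
  · have a := (hc1.tendsto x₀).comp hxlim
    have b := hlim1.comp hφ.tendsto_atTop
    refine tendsto_nhds_unique a (b.congr fun k => (hxy _).symm)
  · exact le_of_tendsto_of_tendsto' (hlim2.comp hφ.tendsto_atTop) ((hc2.tendsto x₀).comp hxlim)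
      fun k => hpay _

theorem convex_hypograph (V : Fin n → Matrix (M × H) (M × H) ℂ) (E : C → O → Matrix H H ℂ) :
    Convex ℝ (hypograph V E) := by
  rintro y ⟨x, hx, hxy, hp⟩ y' ⟨x', hx', hxy', hp'⟩ a b ha hb -
  refine ⟨a • x + b • x', psdCone_add (psdCone_smul hx ha) (psdCone_smul hx' hb), ?_, ?_⟩
  · rw [map_add, map_smul, map_smul, hxy, hxy']; rfl
  · rw [map_add, map_smul, map_smul]
    exact add_le_add (mul_le_mul_of_nonneg_left hp ha) (mul_le_mul_of_nonneg_left hp' hb)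

end Duality

/-! ### From a dominating functional to dual operators. -/

section Dual

variable {H M C O : Type} [Fintype H] [DecidableEq H] [Fintype M] [DecidableEq M]
  [Fintype C] [DecidableEq C] [Fintype O] [DecidableEq O] {n : ℕ}

/-- The constraint values of a feasible solution that starts in the state `σ`. -/
def target (C : Type) (n : ℕ) (σ : Matrix H H ℂ) :
    (Fin n → Matrix H H ℂ) × (C → Matrix H H ℂ) :=
  (fun i => (Fin.cons σ fun _ => 0 : Fin (n + 1) → Matrix H H ℂ) i.castSucc,
    fun _ => (Fin.cons σ fun _ => 0 : Fin (n + 1) → Matrix H H ℂ) (Fin.last n))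

theorem incoming_isHermitian {V : Fin n → Matrix (M × H) (M × H) ℂ}
    {ρ : Fin n → Matrix (M × H) (M × H) ℂ} (hρ : ∀ i, (ρ i).PosSemidef) (j : Fin (n + 1)) :
    (incoming V ρ j).IsHermitian := by
  refine Fin.cases ?_ (fun i => ?_) j
  · simp [incoming]
  · exact ptrace_isHermitian ((hρ i).mul_mul_conjTranspose_same _).isHermitian

/-- A functional that dominates the payoff is given by a sequence of operators, each of which
dominates the next one. -/
theorem exists_dual_of_functional (V : Fin n → Matrix (M × H) (M × H) ℂ)
    (E : C → O → Matrix H H ℂ) (hE : ∀ c o, (E c o).IsHermitian)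
    (z : ((Fin n → Matrix H H ℂ) × (C → Matrix H H ℂ)) →ₗ[ℝ] ℝ)
    (hz : ∀ x ∈ psdCone H M C O n, payoff E x ≤ z (constraintMap V x)) :
    ∃ (Z : Fin (n + 1) → Matrix H H ℂ) (W : C → Matrix H H ℂ),
      (∀ i : Fin n, ((1 : Matrix M M ℂ) ⊗ₖ Z i.castSucc
        - (V i)ᴴ * ((1 : Matrix M M ℂ) ⊗ₖ Z i.succ) * V i).PosSemidef) ∧
      Z (Fin.last n) = ∑ c, W c ∧ (∀ c o, (W c - E c o).PosSemidef) ∧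
      ∀ σ : Matrix H H ℂ, σ.IsHermitian → z (target C n σ) = (Z 0 * σ).trace.re := by
  choose Y hYH hY using fun i : Fin n => exists_isHermitian_trace
    (z ∘ₗ LinearMap.inl ℝ _ _ ∘ₗ LinearMap.single ℝ (fun _ => Matrix H H ℂ) i)
  choose W hWH hW using fun c : C => exists_isHermitian_trace
    (z ∘ₗ LinearMap.inr ℝ _ _ ∘ₗ LinearMap.single ℝ (fun _ => Matrix H H ℂ) c)
  have hsplit : ∀ w : (Fin n → Matrix H H ℂ) × (C → Matrix H H ℂ), (∀ i, (w.1 i).IsHermitian) →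
      (∀ c, (w.2 c).IsHermitian) →
      z w = ∑ i, (Y i * w.1 i).trace.re + ∑ c, (W c * w.2 c).trace.re := by
    intro w h1 h2
    have e : w = ∑ i, LinearMap.inl ℝ (Fin n → Matrix H H ℂ) (C → Matrix H H ℂ) (Pi.single i (w.1 i))
        + ∑ c, LinearMap.inr ℝ (Fin n → Matrix H H ℂ) (C → Matrix H H ℂ) (Pi.single c (w.2 c)) := by
      rw [← map_sum, ← map_sum, Finset.univ_sum_single, Finset.univ_sum_single]
      simp
    conv_lhs => rw [e]
    rw [map_add, map_sum, map_sum]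
    congr 1
    · exact Finset.sum_congr rfl fun i _ => hY i _ (h1 i)
    · exact Finset.sum_congr rfl fun c _ => hW c _ (h2 c)
  let Z : Fin (n + 1) → Matrix H H ℂ := Fin.snoc Y (∑ c, W c)
  have hZc : ∀ i : Fin n, Z i.castSucc = Y i := fun i => Fin.snoc_castSucc _ _ _
  have hZl : Z (Fin.last n) = ∑ c, W c := Fin.snoc_last _ _
  have hWsum : (∑ c, W c).IsHermitian := by
    rw [Matrix.IsHermitian, Matrix.conjTranspose_sum]
    exact Finset.sum_congr rfl fun c _ => hWH c
  have hZH : ∀ j, (Z j).IsHermitian := fun j => by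
    refine Fin.lastCases ?_ (fun i => ?_) j
    · rw [hZl]; exact hWsum
    · rw [hZc]; exact hYH i
  -- Summation by parts: the multiplier of constraint `i + 1` is paired with the state that round
  -- `i` hands on. At the last index `Z` is `∑ c, W c`, because all questions `c` share the same
  -- final state.
  have hcomb : ∀ w : Fin (n + 1) → Matrix H H ℂ,
      ∑ i : Fin n, (Y i * w i.castSucc).trace.re + ∑ c, (W c * w (Fin.last n)).trace.re
        = (Z 0 * w 0).trace.re + ∑ i : Fin n, (Z i.succ * w i.succ).trace.re := by
    intro w
    rw [← Fin.sum_univ_succ (fun j => (Z j * w j).trace.re), Fin.sum_univ_castSucc]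
    simp only [hZc, hZl, Finset.sum_mul, Matrix.trace_sum, Complex.re_sum]
  have hmain : ∀ x ∈ psdCone H M C O n, payoff E x ≤
      ∑ i, ((((1 : Matrix M M ℂ) ⊗ₖ Z i.castSucc
        - (V i)ᴴ * ((1 : Matrix M M ℂ) ⊗ₖ Z i.succ) * V i) * x.1 i).trace).re
      + ∑ c, ∑ o, (W c * x.2 c o).trace.re := by
    intro x hx
    refine (hz x hx).trans (le_of_eq ?_)
    have hτ : ∀ c, (∑ o, x.2 c o).IsHermitian := fun c => by
      rw [Matrix.IsHermitian, Matrix.conjTranspose_sum]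
      exact Finset.sum_congr rfl fun o _ => (hx.2 c o).isHermitian
    rw [hsplit _ (fun i => (ptrace_isHermitian (hx.1 i).isHermitian).sub (incoming_isHermitian hx.1 _))
      (fun c => (hτ c).sub (incoming_isHermitian hx.1 _))]
    have h1 := hcomb (incoming V x.1)
    simp only [constraintMap, LinearMap.coe_mk, AddHom.coe_mk, Matrix.mul_sub, Matrix.trace_sub,
      Complex.sub_re, Finset.sum_sub_distrib, Matrix.sub_mul, Finset.mul_sum, Matrix.trace_sum,
      Complex.re_sum]
    have h2 : ∀ i : Fin n, (Z i.succ * incoming V x.1 i.succ).trace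
        = ((V i)ᴴ * ((1 : Matrix M M ℂ) ⊗ₖ Z i.succ) * V i * x.1 i).trace := by
      intro i
      have : incoming V x.1 i.succ = ptrace (V i * x.1 i * (V i)ᴴ) := by simp [incoming]
      rw [this, trace_mul_ptrace, ← Matrix.mul_assoc, Matrix.trace_mul_comm]
      simp only [Matrix.mul_assoc]
    have h3 : incoming V x.1 0 = 0 := by simp [incoming]
    simp only [h2, h3, Matrix.mul_zero, Matrix.trace_zero, Complex.zero_re, zero_add] at h1
    simp only [trace_mul_ptrace, hZc]
    linarith
  refine ⟨Z, W, fun i => ?_, hZl, fun c o => ?_, fun σ hσ => ?_⟩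
  · refine posSemidef_of_trace_nonneg ?_ fun X hX => ?_
    · refine Matrix.IsHermitian.sub ?_ ?_
      · rw [Matrix.IsHermitian, Matrix.conjTranspose_kronecker, hZH, Matrix.conjTranspose_one]
      · refine Matrix.isHermitian_conjTranspose_mul_mul _ ?_
        rw [Matrix.IsHermitian, Matrix.conjTranspose_kronecker, hZH, Matrix.conjTranspose_one]
    -- Each dual inequality is obtained by testing candidates with a single nonzero component.
    · have h := hmain (Pi.single i X, 0) ⟨fun k => ?_, fun c o => Matrix.PosSemidef.zero⟩
      · rw [Finset.sum_eq_single i] at h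
        · simpa [payoff] using h
        · intro k _ hk; simp [Pi.single_eq_of_ne hk]
        · simp
      · by_cases hk : k = i
        · subst hk; simpa using hX
        · simpa [Pi.single_eq_of_ne hk] using Matrix.PosSemidef.zero
  · refine posSemidef_of_trace_nonneg ((hWH c).sub (hE c o)) fun X hX => ?_
    have h := hmain (0, Pi.single c (Pi.single o X))
      ⟨fun k => Matrix.PosSemidef.zero, fun c' o' => ?_⟩
    · have hs : ∀ F : C → O → Matrix H H ℂ, ∑ c', ∑ o', (F c' o' *
          (Pi.single c (Pi.single o X) : C → O → Matrix H H ℂ) c' o').trace.re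
            = (F c o * X).trace.re := by
        intro F
        rw [Finset.sum_eq_single c, Finset.sum_eq_single o]
        · simp
        · intro k _ hk; simp [Pi.single_eq_of_ne hk]
        · simp
        · intro k _ hk; simp [Pi.single_eq_of_ne hk]
        · simp
      have h' : (E c o * X).trace.re ≤ (W c * X).trace.re := by
        rw [← hs E, ← hs fun c _ => W c]
        simpa [payoff] using h
      rw [Matrix.sub_mul, Matrix.trace_sub, Complex.sub_re]
      linarith
    · by_cases hc : c' = c
      · subst hc
        by_cases ho : o' = o
        · subst ho; simpa using hX
        · simpa [Pi.single_eq_of_ne ho] using Matrix.PosSemidef.zero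
      · simpa [Pi.single_eq_of_ne hc] using Matrix.PosSemidef.zero
  · have hh : ∀ j, ((Fin.cons σ fun _ => 0 : Fin (n + 1) → Matrix H H ℂ) j).IsHermitian := fun j => by
      refine Fin.cases ?_ (fun i => ?_) j
      · simpa using hσ
      · simp
    rw [hsplit _ (fun i => hh _) (fun c => hh _)]
    simp only [target]
    rw [hcomb]
    simp

end Dual

/-! ### Strong duality by separation of a point from the hypograph. -/

section StrongDuality

variable {H M C O : Type} [Fintype H] [DecidableEq H] [Fintype M] [DecidableEq M]
  [Fintype C] [DecidableEq C] [Fintype O] [DecidableEq O] {n : ℕ}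

theorem posSemidef_of_one_kronecker [Nonempty M] {Z : Matrix H H ℂ}
    (h : ((1 : Matrix M M ℂ) ⊗ₖ Z).PosSemidef) : Z.PosSemidef := by
  have := h.submatrix fun k : H => (Classical.arbitrary M, k)
  convert this using 1
  ext i j
  simp

/-- Backward induction: `1 ⊗ Z i` dominates a conjugate of a positive operator, and a diagonal block
of `1 ⊗ Z i` is `Z i` itself. -/
theorem posSemidef_of_dominates [Nonempty M] {V : Fin n → Matrix (M × H) (M × H) ℂ}
    {Z : Fin (n + 1) → Matrix H H ℂ}
    (h : ∀ i : Fin n, ((1 : Matrix M M ℂ) ⊗ₖ Z i.castSucc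
        - (V i)ᴴ * ((1 : Matrix M M ℂ) ⊗ₖ Z i.succ) * V i).PosSemidef)
    (hn : (Z (Fin.last n)).PosSemidef) (j : Fin (n + 1)) : (Z j).PosSemidef := by
  induction j using Fin.reverseInduction with
  | last => exact hn
  | cast i ih =>
    have h1 := (h i).add ((Matrix.PosSemidef.one.kronecker ih).conjTranspose_mul_mul_same (V i))
    rw [sub_add_cancel] at h1
    exact posSemidef_of_one_kronecker h1

theorem posSemidef_sum {ι : Type} (s : Finset ι) {F : ι → Matrix H H ℂ}
    (h : ∀ i ∈ s, (F i).PosSemidef) : (∑ i ∈ s, F i).PosSemidef :=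
  Finset.sum_induction F Matrix.PosSemidef (fun _ _ => Matrix.PosSemidef.add)
    Matrix.PosSemidef.zero h

/-- Strong duality: if no sequence of states that a cheater can produce wins with probability more
than `v`, then a sequence of operators certifies this up to an arbitrarily small error. -/
theorem exists_dual [Nonempty M] [Nonempty O] (V : ℕ → Matrix.unitaryGroup (M × H) ℂ)
    {σ : Matrix H H ℂ} (hσ : σ.PosSemidef) {E : C → O → Matrix H H ℂ}
    (hE : ∀ c o, (E c o).PosSemidef) {v v' : ℝ} (hv : v < v')
    (hprimal : ∀ (ρ : ℕ → Matrix (M × H) (M × H) ℂ) (s : ℕ → Matrix H H ℂ)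
      (τ : C → O → Matrix H H ℂ), (∀ i < n, (ρ i).PosSemidef) → s 0 = σ →
      (∀ i < n, ptrace (ρ i) = s i) →
      (∀ i < n, s (i + 1) = ptrace ((V i : Matrix (M × H) (M × H) ℂ) * ρ i
        * (V i : Matrix (M × H) (M × H) ℂ)ᴴ)) →
      (∀ c o, (τ c o).PosSemidef) → (∀ c, ∑ o, τ c o = s n) →
      ∑ c, ∑ o, (E c o * τ c o).trace.re ≤ v) :
    ∃ (Z : ℕ → Matrix H H ℂ) (W : C → Matrix H H ℂ),
      (∀ i ≤ n, (Z i).PosSemidef) ∧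
      (∀ i < n, ((1 : Matrix M M ℂ) ⊗ₖ Z i - (V i : Matrix (M × H) (M × H) ℂ)ᴴ
        * ((1 : Matrix M M ℂ) ⊗ₖ Z (i + 1)) * (V i : Matrix (M × H) (M × H) ℂ)).PosSemidef) ∧
      Z n = ∑ c, W c ∧ (∀ c o, (W c - E c o).PosSemidef) ∧ (Z 0 * σ).trace.re < v' := by
  let V' : Fin n → Matrix (M × H) (M × H) ℂ := fun i => (V i : Matrix (M × H) (M × H) ℂ)
  have hV' : ∀ i, (V' i)ᴴ * V' i = 1 := fun i => Matrix.mem_unitaryGroup_iff'.1 (V i).2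
  -- A point of the hypograph over `target` is a feasible solution, once `σ` is put back in front of
  -- the incoming states; its payoff is at most `v < v'`.
  have hnot : (target C n σ, v') ∉ hypograph V' E := by
    rintro ⟨x, hx, hxy, hp⟩
    let S : Fin (n + 1) → Matrix H H ℂ := Fin.cons σ fun i => ptrace (V' i * x.1 i * (V' i)ᴴ)
    have hS : S = (Fin.cons σ fun _ => 0) + incoming V' x.1 := by
      funext j
      refine Fin.cases ?_ (fun i => ?_) j
      · simp [S, incoming]
      · simp [S, incoming]
    have h1 : ∀ i : Fin n, ptrace (x.1 i) = S i.castSucc := fun i => by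
      have := congrFun (congrArg Prod.fst hxy) i
      simp only [constraintMap, LinearMap.coe_mk, AddHom.coe_mk, target] at this
      rw [hS, Pi.add_apply, ← this, sub_add_cancel]
    have h2 : ∀ c, ∑ o, x.2 c o = S (Fin.last n) := fun c => by
      have := congrFun (congrArg Prod.snd hxy) c
      simp only [constraintMap, LinearMap.coe_mk, AddHom.coe_mk, target] at this
      rw [hS, Pi.add_apply, ← this, sub_add_cancel]
    have h3 := hprimal (fun i => if h : i < n then x.1 ⟨i, h⟩ else 0)
      (fun i => S ⟨min i n, by omega⟩) x.2
      (fun i hi => by simpa [hi] using hx.1 ⟨i, hi⟩) (by simp [S])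
      (fun i hi => by
        simp only [hi, dif_pos, h1]
        congr 1
        ext
        simp [hi.le])
      (fun i hi => by
        have : (⟨min (i + 1) n, by omega⟩ : Fin (n + 1)) = (⟨i, hi⟩ : Fin n).succ := by
          ext; simp; omega
        simp only [hi, dif_pos, this, S, Fin.cons_succ, V'])
      hx.2 (fun c => by
        rw [h2]
        congr 1
        ext
        simp)
    have hp' : v' ≤ ∑ c, ∑ o, (E c o * x.2 c o).trace.re := hp
    linarith
  have : LocallyConvexSpace ℝ (Matrix H H ℂ) :=
    inferInstanceAs (LocallyConvexSpace ℝ (H → H → ℂ))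
  obtain ⟨φ, u, hφ, hu⟩ := geometric_hahn_banach_closed_point (convex_hypograph V' E)
    (isClosed_hypograph hV' E) hnot
  have hzero : (0 : ((Fin n → Matrix H H ℂ) × (C → Matrix H H ℂ)) × ℝ) ∈ hypograph V' E :=
    ⟨0, psdCone_zero, by simp, by simp⟩
  have hu0 : 0 < u := by simpa using hφ 0 hzero
  -- The hypograph is a cone, so a positive value of `φ` could be rescaled to equal `u`.
  have hcone : ∀ x ∈ psdCone H M C O n, ∀ r ≤ payoff E x, φ (constraintMap V' x, r) ≤ 0 := by
    intro x hx r hr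
    by_contra! hpos
    have hk : 0 ≤ u / φ (constraintMap V' x, r) := by positivity
    have := hφ ((u / φ (constraintMap V' x, r)) • (constraintMap V' x, r))
      ⟨(u / φ (constraintMap V' x, r)) • x, psdCone_smul hx hk, by rw [map_smul]; rfl, by
        rw [map_smul]; exact mul_le_mul_of_nonneg_left hr hk⟩
    rw [map_smul, smul_eq_mul, div_mul_cancel₀ _ hpos.ne'] at this
    exact lt_irrefl _ this
  set t := φ (0, 1) with ht
  let ζ : ((Fin n → Matrix H H ℂ) × (C → Matrix H H ℂ)) →ₗ[ℝ] ℝ :=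
    φ.toLinearMap ∘ₗ LinearMap.inl ℝ _ _
  have hsplit : ∀ w r, φ (w, r) = ζ w + r * t := by
    intro w r
    have : (w, r) = (w, (0 : ℝ)) + r • ((0 : (Fin n → Matrix H H ℂ) × (C → Matrix H H ℂ)), (1 : ℝ)) := by
      simp
    rw [this, map_add, map_smul]
    rfl
  have ht0 : 0 ≤ t := by
    have := hcone 0 psdCone_zero (-1) (by simp)
    rw [hsplit] at this
    simp at this
    exact this
  have hpsd : ∀ {F : C → O → Matrix H H ℂ} {W : C → Matrix H H ℂ}, (∀ c o, (F c o).PosSemidef) →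
      (∀ c o, (W c - F c o).PosSemidef) → (∑ c, W c).PosSemidef := by
    intro F W hF hWF
    refine posSemidef_sum _ fun c _ => ?_
    have := (hWF c (Classical.arbitrary O)).add (hF c (Classical.arbitrary O))
    rwa [sub_add_cancel] at this
  rw [hsplit] at hu
  -- The separating hyperplane is not vertical. If `t = 0`, then `-ζ` is a dual solution for payoff
  -- zero; its operators are positive, so `ζ (target C n σ) ≤ 0`, against `hu` and `0 < u`.
  have htpos : 0 < t := by
    refine ht0.lt_of_ne fun h0 => ?_
    rw [← h0, mul_zero, add_zero] at hu
    obtain ⟨Z, W, hZ, hZn, hW, hσZ⟩ := exists_dual_of_functional V' (0 : C → O → Matrix H H ℂ)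
      (fun _ _ => Matrix.isHermitian_zero) (-ζ) (fun x hx => by
        have := hcone x hx _ le_rfl
        rw [hsplit, ← h0, mul_zero, add_zero] at this
        have e : payoff (0 : C → O → Matrix H H ℂ) x = 0 := by simp [payoff]
        rw [e, LinearMap.neg_apply]
        linarith)
    have hZ0 := posSemidef_of_dominates hZ
      (by rw [hZn]; exact hpsd (fun _ _ => Matrix.PosSemidef.zero) hW) 0
    have h1 := hσZ σ hσ.isHermitian
    obtain ⟨R, rfl⟩ := exists_eq_mul_conjTranspose_self hσ
    have h2 : 0 ≤ (Z 0 * (R * Rᴴ)).trace.re := by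
      rw [← Matrix.mul_assoc, Matrix.trace_mul_comm, ← Matrix.mul_assoc]
      exact (Complex.nonneg_iff.1 (hZ0.conjTranspose_mul_mul_same R).trace_nonneg).1
    rw [LinearMap.neg_apply] at h1
    linarith
  obtain ⟨Z, W, hZ, hZn, hW, hσZ⟩ := exists_dual_of_functional V' E
    (fun c o => (hE c o).isHermitian) ((-t⁻¹) • ζ) (fun x hx => by
      have := hcone x hx _ le_rfl
      rw [hsplit] at this
      rw [LinearMap.smul_apply, smul_eq_mul, neg_mul, ← sub_nonneg]
      have e : -(t⁻¹ * ζ (constraintMap V' x)) - payoff E x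
          = -(ζ (constraintMap V' x) + payoff E x * t) / t := by field_simp; ring
      rw [e]
      exact div_nonneg (by linarith) htpos.le)
  have hZpsd := posSemidef_of_dominates hZ (by rw [hZn]; exact hpsd hE hW)
  refine ⟨fun i => Z ⟨min i n, by omega⟩, W, fun i _ => hZpsd _, fun i hi => ?_, ?_, hW, ?_⟩
  · have e1 : (⟨min i n, by omega⟩ : Fin (n + 1)) = (⟨i, hi⟩ : Fin n).castSucc := by
      ext; simp; omega
    have e2 : (⟨min (i + 1) n, by omega⟩ : Fin (n + 1)) = (⟨i, hi⟩ : Fin n).succ := by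
      ext; simp; omega
    simp only [e1, e2]
    exact hZ ⟨i, hi⟩
  · have e : (⟨min n n, by omega⟩ : Fin (n + 1)) = Fin.last n := by ext; simp
    simp only [e, hZn]
  · have h1 := hσZ σ hσ.isHermitian
    have e : (⟨min 0 n, by omega⟩ : Fin (n + 1)) = 0 := by ext; simp
    simp only [e]
    rw [← h1, LinearMap.smul_apply, smul_eq_mul, ← sub_pos]
    have e : v' - -t⁻¹ * ζ (target C n σ) = (ζ (target C n σ) + v' * t) / t := by
      field_simp; ring
    rw [e]
    exact div_pos (by linarith) htpos

end StrongDuality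

/-! ### Product vectors -/

section Tens

variable {J L J' L' : Type} [Fintype J] [Fintype L]

/-- The product vector of two vectors. -/
def tens (a : J → ℂ) (b : L → ℂ) : J × L → ℂ := fun p => a p.1 * b p.2

theorem kronecker_mulVec_tens (F : Matrix J' J ℂ) (G : Matrix L' L ℂ) (a : J → ℂ) (b : L → ℂ) :
    (F ⊗ₖ G) *ᵥ tens a b = tens (F *ᵥ a) (G *ᵥ b) := by
  funext p
  rw [kronecker_mulVec_apply]
  simp only [tens, Matrix.mulVec, dotProduct, Finset.sum_mul_sum]
  refine Finset.sum_congr rfl fun j _ => Finset.sum_congr rfl fun l _ => ?_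
  ring

/-- A Hermitian `F` has a real expectation, so the real part of the product splits. -/
theorem prob_tens (a : J → ℂ) (b : L → ℂ) {F : Matrix J J ℂ} (G : Matrix L L ℂ)
    (hF : F.IsHermitian) : prob (tens a b) (F ⊗ₖ G) = prob a F * prob b G := by
  unfold prob
  rw [kronecker_mulVec_tens]
  have : star (tens a b) ⬝ᵥ tens (F *ᵥ a) (G *ᵥ b) = (star a ⬝ᵥ F *ᵥ a) * (star b ⬝ᵥ G *ᵥ b) := by
    simp only [tens, dotProduct, Finset.sum_mul_sum, Fintype.sum_prod_type, Pi.star_apply,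
      star_mul']
    refine Finset.sum_congr rfl fun j _ => Finset.sum_congr rfl fun l _ => ?_
    ring
  have him : (star a ⬝ᵥ F *ᵥ a).im = 0 := hF.im_star_dotProduct_mulVec_self a
  rw [this, Complex.mul_re, him]
  ring

theorem red_tens_single [DecidableEq J] (j : J) (b : L → ℂ) :
    red (tens (Pi.single j 1) b) = Matrix.vecMulVec b (star b) := by
  ext l l'
  rw [red_apply, Finset.sum_eq_single j]
  · simp [tens, Matrix.vecMulVec_apply]
  · intro k _ hk; simp [tens, Pi.single_eq_of_ne hk]
  · simp

theorem tens_single_single [DecidableEq J] [DecidableEq L] (j : J) (l : L) :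
    tens (Pi.single j 1) (Pi.single l 1) = Pi.single (j, l) 1 := by
  funext p
  by_cases h1 : p.1 = j
  · by_cases h2 : p.2 = l
    · obtain ⟨p1, p2⟩ := p
      simp only at h1 h2
      subst h1 h2
      simp [tens]
    · rw [Pi.single_eq_of_ne (fun h => h2 (by rw [h]))]
      simp [tens, Pi.single_eq_of_ne h2]
  · rw [Pi.single_eq_of_ne (fun h => h1 (by rw [h]))]
    simp [tens, Pi.single_eq_of_ne h1]

theorem red_grp_tens_single {K M H : Type} [Fintype K] [DecidableEq K] [Fintype M]
    [Fintype H] (k : K) (θ : M × H → ℂ) : red (grp (tens (Pi.single k 1) θ)) = red θ := by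
  ext h h'
  simp only [red_apply, grp, Fintype.sum_prod_type]
  rw [Finset.sum_eq_single k]
  · simp [tens]
  · intro j _ hj; simp [tens, Pi.single_eq_of_ne hj]
  · simp

theorem trace_mul_red_of_vecMulVec (Z : Matrix L L ℂ) (b : L → ℂ) :
    (Z * Matrix.vecMulVec b (star b)).trace.re = prob b Z := by
  rw [Matrix.mul_vecMulVec, Matrix.trace_vecMulVec, dotProduct_comm]
  rfl

end Tens

/-! ### Dual certificates against a cheater -/

section CheaterDual

variable {H M C O : Type} [Fintype H] [DecidableEq H] [Fintype M] [DecidableEq M]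
  [Fintype C] [DecidableEq C] [Fintype O] [DecidableEq O] {n : ℕ}

/-- If a cheater, whoever starts with a product of a basis state and the vector `θ` of `M ⊗ H`,
cannot win with probability more than `v`, then there is a dual certificate for this. -/
theorem exists_cheater_dual [Nonempty O] (m₀ : M) (V : ℕ → Matrix.unitaryGroup (M × H) ℂ)
    (θ : M × H → ℂ) {E : C → O → Matrix H H ℂ} (hE : ∀ c o, (E c o).PosSemidef) {v v' : ℝ}
    (hv : v < v')
    (hcheat : ∀ (K : Type) (_ : Fintype K) (_ : DecidableEq K) (k : K)
      (U : ℕ → Matrix.unitaryGroup (K × M) ℂ) (G : C → POVM O (K × M)),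
      (∀ c, (G c).IsProjective) →
      ∑ c, ∑ o, prob (evolve U V (tens (Pi.single k 1) θ) n)
        (tensorLeft ((G c).op o) (E c o)) ≤ v) :
    ∃ (Z : ℕ → Matrix H H ℂ) (W : C → Matrix H H ℂ),
      (∀ i ≤ n, (Z i).PosSemidef) ∧
      (∀ i < n, ((1 : Matrix M M ℂ) ⊗ₖ Z i - (V i : Matrix (M × H) (M × H) ℂ)ᴴ
        * ((1 : Matrix M M ℂ) ⊗ₖ Z (i + 1)) * (V i : Matrix (M × H) (M × H) ℂ)).PosSemidef) ∧
      Z n = ∑ c, W c ∧ (∀ c o, (W c - E c o).PosSemidef) ∧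
      prob θ ((1 : Matrix M M ℂ) ⊗ₖ Z 0) < v' := by
  have : Nonempty M := ⟨m₀⟩
  obtain ⟨Z, W, h1, h2, h3, h4, h5⟩ := exists_dual (n := n) V (red_posSemidef θ) hE hv
    (fun ρ s τ hρ hs0 hin hout hτ hsum => by
      -- Room for purifying every state of `M ⊗ H` and for storing an answer in `O`; `none` is a
      -- starting state that exists even when the other labels do not.
      let K := Option ((M × H) × O)
      let o₀ : O := Classical.arbitrary O
      let ι : M × H → K := fun p => some (p, o₀)
      have hι : Function.Injective ι := fun p q h => congrArg Prod.fst (Option.some_injective _ h)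
      obtain ⟨U, hU⟩ := exists_strategy hι (tens (Pi.single none 1) θ) V n hρ
        (by rw [hs0, red_grp_tens_single]) hin hout
      let κ : O × H → K × M := fun p => (some ((m₀, p.2), p.1), m₀)
      have hκ : Function.Injective κ := fun p q h => by
        have h' := Option.some_injective _ (congrArg Prod.fst h)
        exact Prod.ext (congrArg Prod.snd h') (congrArg (fun r => r.1.2) h')
      choose G hG hG' using fun c => exists_povm_of_red_eq_sum hκ (hτ c) (hU.trans (hsum c).symm)
      have := hcheat K inferInstance inferInstance none U G hG
      simpa only [prob_tensorLeft, hG'] using this)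
  refine ⟨Z, W, h1, h2, h3, h4, ?_⟩
  rwa [prob_one_kronecker]

end CheaterDual

/-! ### Exchanging the parties -/

section Swap

variable {A M B : Type} [Fintype A] [DecidableEq A] [Fintype M] [DecidableEq M]
  [Fintype B] [DecidableEq B]

/-- The vector with the roles of the two parties exchanged. -/
def rev (ψ : A × M × B → ℂ) : B × M × A → ℂ := fun p => ψ (p.2.2, p.2.1, p.1)

theorem submatrix_swap_mul (X Y : Matrix (A × M) (A × M) ℂ) :
    X.submatrix Prod.swap Prod.swap * Y.submatrix Prod.swap Prod.swap
      = (X * Y).submatrix (Prod.swap : M × A → A × M) Prod.swap := by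
  have := Matrix.submatrix_mul_equiv X Y (Prod.swap : M × A → A × M) (Equiv.prodComm M A) Prod.swap
  rwa [Equiv.coe_prodComm] at this

theorem submatrix_swap_one :
    (1 : Matrix (A × M) (A × M) ℂ).submatrix (Prod.swap : M × A → A × M) Prod.swap = 1 := by
  have := Matrix.submatrix_one_equiv (α := ℂ) (Equiv.prodComm M A)
  rwa [Equiv.coe_prodComm] at this

/-- A unitary on `A ⊗ M` as a unitary on `M ⊗ A`. -/
def swapU (U : Matrix.unitaryGroup (A × M) ℂ) : Matrix.unitaryGroup (M × A) ℂ :=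
  ⟨(U : Matrix (A × M) (A × M) ℂ).submatrix Prod.swap Prod.swap, by
    rw [Matrix.mem_unitaryGroup_iff', Matrix.star_eq_conjTranspose, Matrix.conjTranspose_submatrix,
      submatrix_swap_mul, ← Matrix.star_eq_conjTranspose, Matrix.mem_unitaryGroup_iff'.1 U.2,
      submatrix_swap_one]⟩

theorem swapU_apply (U : Matrix.unitaryGroup (A × M) ℂ) (p q : M × A) :
    (swapU U : Matrix (M × A) (M × A) ℂ) p q = (U : Matrix (A × M) (A × M) ℂ) p.swap q.swap := rfl

theorem swapU_swapU (U : Matrix.unitaryGroup (A × M) ℂ) : swapU (swapU U) = U := by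
  ext p q
  rfl

/-- A measurement on `A ⊗ M` as a measurement on `M ⊗ A`. -/
def POVM.swap {O : Type} [Fintype O] (G : POVM O (A × M)) : POVM O (M × A) where
  op o := (G.op o).submatrix Prod.swap Prod.swap
  posSemidef o := (G.posSemidef o).submatrix _
  sum_eq_one := by
    have h := G.sum_eq_one
    have e : ∑ o, (G.op o).submatrix Prod.swap Prod.swap
        = (∑ o, G.op o).submatrix (Prod.swap : M × A → A × M) Prod.swap := by
      ext p q
      simp [Matrix.sum_apply]
    rw [e, h, submatrix_swap_one]

theorem POVM.IsProjective.swap {O : Type} [Fintype O] {G : POVM O (A × M)} (h : G.IsProjective) :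
    G.swap.IsProjective where
  mul_self o := by
    show (G.op o).submatrix Prod.swap Prod.swap * (G.op o).submatrix Prod.swap Prod.swap = _
    rw [submatrix_swap_mul, h.mul_self]
    rfl

theorem tensorLeft_one_mulVec_apply (X : Matrix (A × M) (A × M) ℂ) (ψ : A × M × B → ℂ)
    (p : A × M × B) : (tensorLeft X (1 : Matrix B B ℂ) *ᵥ ψ) p
      = ∑ q : A × M, X (p.1, p.2.1) q * ψ (q.1, q.2, p.2.2) := by
  have := congrFun (grp_tensorLeft_mulVec X (1 : Matrix B B ℂ) ψ) ((p.1, p.2.1), p.2.2)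
  rw [kronecker_one_mulVec_apply] at this
  exact this

theorem rev_tensorLeft_mulVec (U : Matrix.unitaryGroup (A × M) ℂ) (ψ : A × M × B → ℂ) :
    rev (tensorLeft (U : Matrix (A × M) (A × M) ℂ) (1 : Matrix B B ℂ) *ᵥ ψ)
      = ((1 : Matrix B B ℂ) ⊗ₖ (swapU U : Matrix (M × A) (M × A) ℂ)) *ᵥ rev ψ := by
  funext p
  rw [one_kronecker_mulVec_apply]
  simp only [rev, tensorLeft_one_mulVec_apply, swapU_apply]
  exact (Equiv.sum_comp (Equiv.prodComm M A) _).symm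

theorem rev_kronecker_mulVec (V : Matrix.unitaryGroup (M × B) ℂ) (ψ : A × M × B → ℂ) :
    rev (((1 : Matrix A A ℂ) ⊗ₖ (V : Matrix (M × B) (M × B) ℂ)) *ᵥ ψ)
      = tensorLeft (swapU V : Matrix (B × M) (B × M) ℂ) (1 : Matrix A A ℂ) *ᵥ rev ψ := by
  funext p
  rw [tensorLeft_one_mulVec_apply]
  simp only [rev, one_kronecker_mulVec_apply, swapU_apply]
  exact (Equiv.sum_comp (Equiv.prodComm B M) _).symm

theorem prob_rev (ψ : A × M × B → ℂ) (X : Matrix (B × M) (B × M) ℂ) (F : Matrix A A ℂ) :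
    prob (rev ψ) (tensorLeft X F) = prob ψ (F ⊗ₖ X.submatrix Prod.swap Prod.swap) := by
  let e : A × M × B ≃ B × M × A :=
    ⟨fun p => (p.2.2, p.2.1, p.1), fun p => (p.2.2, p.2.1, p.1), fun _ => rfl, fun _ => rfl⟩
  have h : F ⊗ₖ X.submatrix Prod.swap Prod.swap = (tensorLeft X F).submatrix e e := by
    ext p q
    simp [tensorLeft, e, mul_comm, Prod.swap]
  rw [h, prob_submatrix]
  rfl

/-- The vector after Alice's move in round `k + 1`, seen from the side of Bob. -/
theorem rev_evolve (U : ℕ → Matrix.unitaryGroup (A × M) ℂ) (V : ℕ → Matrix.unitaryGroup (M × B) ℂ)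
    (ψ₀ : A × M × B → ℂ) (k : ℕ) :
    rev (tensorLeft (U k : Matrix (A × M) (A × M) ℂ) (1 : Matrix B B ℂ) *ᵥ evolve U V ψ₀ k)
      = evolve (fun i => swapU (V i)) (fun i => swapU (U (i + 1)))
          (rev (tensorLeft (U 0 : Matrix (A × M) (A × M) ℂ) (1 : Matrix B B ℂ) *ᵥ ψ₀)) k := by
  induction k with
  | zero => rfl
  | succ k ih => rw [evolve, evolve, ← ih, rev_tensorLeft_mulVec, rev_kronecker_mulVec]

end Swap

/-! ### The product bound for two cheaters -/

section Kitaev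

variable {A M B C O : Type} [Fintype A] [DecidableEq A] [Fintype M] [DecidableEq M]
  [Fintype B] [DecidableEq B] [Fintype C] [DecidableEq C] [Fintype O] [DecidableEq O]

/-- The product of Alice's vector `α`, the basis state `m₀` and Bob's vector `β`. -/
def prodVec (α : A → ℂ) (m₀ : M) (β : B → ℂ) : A × M × B → ℂ := tens α (tens (Pi.single m₀ 1) β)

theorem rev_prodVec (α : A → ℂ) (m₀ : M) (β : B → ℂ) :
    rev (prodVec α m₀ β) = prodVec β m₀ α := by
  funext p
  simp only [rev, prodVec, tens]
  ring

theorem grp_prodVec (α : A → ℂ) (m₀ : M) (β : B → ℂ) :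
    grp (prodVec α m₀ β) = tens (tens α (Pi.single m₀ 1)) β := by
  funext p
  simp only [grp, prodVec, tens]
  ring

theorem kronecker_sub {J L : Type} (X : Matrix J J ℂ) (Y Y' : Matrix L L ℂ) :
    X ⊗ₖ (Y - Y') = X ⊗ₖ Y - X ⊗ₖ Y' := by
  ext p q
  simp [mul_sub]

theorem sub_kronecker {J L : Type} (X X' : Matrix J J ℂ) (Y : Matrix L L ℂ) :
    (X - X') ⊗ₖ Y = X ⊗ₖ Y - X' ⊗ₖ Y := by
  ext p q
  simp [sub_mul]

theorem sum_kronecker {ι J L : Type} (s : Finset ι) (X : ι → Matrix J J ℂ) (Y : Matrix L L ℂ) :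
    (∑ i ∈ s, X i) ⊗ₖ Y = ∑ i ∈ s, X i ⊗ₖ Y := by
  ext p q
  simp [Matrix.sum_apply, Finset.sum_mul]

theorem kronecker_sum {ι J L : Type} (s : Finset ι) (X : Matrix J J ℂ) (Y : ι → Matrix L L ℂ) :
    X ⊗ₖ (∑ i ∈ s, Y i) = ∑ i ∈ s, X ⊗ₖ Y i := by
  ext p q
  simp [Matrix.sum_apply, Finset.mul_sum]

theorem tensorLeft_sub (X X' : Matrix (A × M) (A × M) ℂ) (Y : Matrix B B ℂ) :
    tensorLeft (X - X') Y = tensorLeft X Y - tensorLeft X' Y := by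
  unfold tensorLeft
  rw [sub_kronecker]
  rfl

theorem prob_swap (θ : A × M → ℂ) (W : Matrix A A ℂ) :
    prob (θ ∘ Prod.swap) ((1 : Matrix M M ℂ) ⊗ₖ W) = prob θ (W ⊗ₖ (1 : Matrix M M ℂ)) := by
  have h : (1 : Matrix M M ℂ) ⊗ₖ W
      = (W ⊗ₖ (1 : Matrix M M ℂ)).submatrix (Equiv.prodComm M A) (Equiv.prodComm M A) := by
    ext p q
    simp [mul_comm, Prod.swap]
  rw [h, prob_submatrix]
  rfl

theorem swapU_mulVec (U : Matrix.unitaryGroup (A × M) ℂ) (θ : A × M → ℂ) :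
    (swapU U : Matrix (M × A) (M × A) ℂ) *ᵥ (θ ∘ Prod.swap)
      = ((U : Matrix (A × M) (A × M) ℂ) *ᵥ θ) ∘ Prod.swap := by
  have := Matrix.submatrix_mulVec_equiv (U : Matrix (A × M) (A × M) ℂ)
    (θ ∘ Prod.swap) Prod.swap (Equiv.prodComm M A)
  exact this

theorem dominates_swap {U : Matrix.unitaryGroup (A × M) ℂ} {W W' : Matrix A A ℂ}
    (h : ((1 : Matrix M M ℂ) ⊗ₖ W - (swapU U : Matrix (M × A) (M × A) ℂ)ᴴ
        * ((1 : Matrix M M ℂ) ⊗ₖ W') * (swapU U : Matrix (M × A) (M × A) ℂ)).PosSemidef) :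
    (W ⊗ₖ (1 : Matrix M M ℂ) - (U : Matrix (A × M) (A × M) ℂ)ᴴ
        * (W' ⊗ₖ (1 : Matrix M M ℂ)) * (U : Matrix (A × M) (A × M) ℂ)).PosSemidef := by
  have e : ∀ X : Matrix A A ℂ, (1 : Matrix M M ℂ) ⊗ₖ X
      = (X ⊗ₖ (1 : Matrix M M ℂ)).submatrix Prod.swap Prod.swap := by
    intro X
    ext p q
    simp [mul_comm, Prod.swap]
  have eU : (swapU U : Matrix (M × A) (M × A) ℂ)
    = (U : Matrix (A × M) (A × M) ℂ).submatrix Prod.swap Prod.swap := rfl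
  rw [e, e, eU, Matrix.conjTranspose_submatrix, submatrix_swap_mul, submatrix_swap_mul] at h
  exact h.submatrix Prod.swap

/-- A dual certificate against a cheating Bob, when Alice moves at least once. -/
theorem exists_bob_dual [Nonempty O] (α : A → ℂ) (m₀ : M) (U : ℕ → Matrix.unitaryGroup (A × M) ℂ)
    (k : ℕ) {F : C → O → Matrix A A ℂ} (hF : ∀ c o, (F c o).PosSemidef) {v v' : ℝ} (hv : v < v')
    (hcheat : ∀ (K : Type) (_ : Fintype K) (_ : DecidableEq K) (b : K)
      (V : ℕ → Matrix.unitaryGroup (M × K) ℂ) (G : C → POVM O (M × K)),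
      (∀ c, (G c).IsProjective) →
      ∑ c, ∑ o, prob (evolve U V (prodVec α m₀ (Pi.single b 1)) (k + 1))
        (F c o ⊗ₖ (G c).op o) ≤ v) :
    ∃ (W : ℕ → Matrix A A ℂ) (Y : C → Matrix A A ℂ),
      (∀ i ≤ k, (W i).PosSemidef) ∧
      (∀ i < k, (W i ⊗ₖ (1 : Matrix M M ℂ) - (U (i + 1) : Matrix (A × M) (A × M) ℂ)ᴴ
        * (W (i + 1) ⊗ₖ (1 : Matrix M M ℂ)) * (U (i + 1) : Matrix (A × M) (A × M) ℂ)).PosSemidef) ∧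
      W k = ∑ c, Y c ∧ (∀ c o, (Y c - F c o).PosSemidef) ∧
      prob ((U 0 : Matrix (A × M) (A × M) ℂ) *ᵥ tens α (Pi.single m₀ 1))
        (W 0 ⊗ₖ (1 : Matrix M M ℂ)) < v' := by
  have hsw : tens (Pi.single m₀ 1) α = tens α (Pi.single m₀ 1) ∘ (Prod.swap : M × A → A × M) := by
    funext p
    simp [tens, mul_comm]
  obtain ⟨W, Y, h1, h2, h3, h4, h5⟩ := exists_cheater_dual (n := k) m₀ (fun i => swapU (U (i + 1)))
    ((swapU (U 0) : Matrix (M × A) (M × A) ℂ) *ᵥ tens (Pi.single m₀ 1) α) hF hv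
    (fun K _ _ k₀ T G hG => by
      -- Seen from Bob, the game starts after Alice's first move and consists of `k` rounds in which
      -- he moves first. His own move in the last round is the identity, since his measurement
      -- follows it directly.
      let V : ℕ → Matrix.unitaryGroup (M × K) ℂ := fun i => if i < k then swapU (T i) else 1
      have h := hcheat K inferInstance inferInstance k₀ V (fun c => (G c).swap)
        (fun c => (hG c).swap)
      have e1 : evolve U V (prodVec α m₀ (Pi.single k₀ 1)) (k + 1)
          = tensorLeft (U k : Matrix (A × M) (A × M) ℂ) (1 : Matrix K K ℂ)
            *ᵥ evolve U V (prodVec α m₀ (Pi.single k₀ 1)) k := by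
        rw [evolve]
        simp [V]
      have e2 := rev_evolve U V (prodVec α m₀ (Pi.single k₀ 1)) k
      rw [rev_tensorLeft_mulVec (U 0), rev_prodVec, prodVec.eq_1 (Pi.single k₀ 1),
        kronecker_mulVec_tens, Matrix.one_mulVec, evolve_congr (U' := T) (V' := fun i => swapU (U (i + 1))) _
          (fun i hi => by simp [V, hi, swapU_swapU]) (fun _ _ => rfl)] at e2
      simp only [← e2, prob_rev]
      simp only [e1] at h
      exact h)
  refine ⟨W, Y, h1, fun i hi => dominates_swap (h2 i hi), h3, h4, ?_⟩
  rwa [hsw, swapU_mulVec, prob_swap] at h5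

/-- A dual certificate against a cheating Bob in a protocol without rounds. -/
theorem exists_bob_dual_zero [Nonempty O] (α : A → ℂ) (m₀ : M)
    {F : C → O → Matrix A A ℂ} (hF : ∀ c o, (F c o).PosSemidef) {v v' : ℝ} (hv : v < v')
    (hcheat : ∀ (K : Type) (_ : Fintype K) (_ : DecidableEq K) (b : K) (G : C → POVM O (M × K)),
      (∀ c, (G c).IsProjective) →
      ∑ c, ∑ o, prob (prodVec α m₀ (Pi.single b 1)) (F c o ⊗ₖ (G c).op o) ≤ v) :
    ∃ (Y : C → Matrix A A ℂ), (∑ c, Y c).PosSemidef ∧ (∀ c o, (Y c - F c o).PosSemidef) ∧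
      prob (tens α (Pi.single m₀ 1)) ((∑ c, Y c) ⊗ₖ (1 : Matrix M M ℂ)) < v' := by
  have hsw : tens (Pi.single m₀ 1) α = tens α (Pi.single m₀ 1) ∘ (Prod.swap : M × A → A × M) := by
    funext p
    simp [tens, mul_comm]
  obtain ⟨W, Y, h1, -, h3, h4, h5⟩ := exists_cheater_dual (n := 0) m₀ (fun _ => 1)
    (tens (Pi.single m₀ 1) α) hF hv
    (fun K _ _ k₀ T G hG => by
      have h := hcheat K inferInstance inferInstance k₀ (fun c => (G c).swap)
        (fun c => (hG c).swap)
      have e2 := rev_prodVec α m₀ (Pi.single k₀ 1)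
      rw [evolve]
      conv at e2 => rhs; rw [prodVec]
      simp only [← e2, prob_rev]
      exact h)
  refine ⟨Y, h3 ▸ h1 0 le_rfl, h4, ?_⟩
  rw [hsw, prob_swap] at h5
  rwa [← h3]

/-- The chain of inequalities that combines the two certificates. -/
theorem prob_evolve_le {U : ℕ → Matrix.unitaryGroup (A × M) ℂ}
    {V : ℕ → Matrix.unitaryGroup (M × B) ℂ} (ψ₀ : A × M × B → ℂ) {k : ℕ}
    {W : ℕ → Matrix A A ℂ} {Z : ℕ → Matrix B B ℂ}
    (hW : ∀ i ≤ k, (W i).PosSemidef) (hZ : ∀ i ≤ k + 1, (Z i).PosSemidef)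
    (hWU : ∀ i < k, (W i ⊗ₖ (1 : Matrix M M ℂ) - (U (i + 1) : Matrix (A × M) (A × M) ℂ)ᴴ
        * (W (i + 1) ⊗ₖ (1 : Matrix M M ℂ)) * (U (i + 1) : Matrix (A × M) (A × M) ℂ)).PosSemidef)
    (hZV : ∀ i < k + 1, ((1 : Matrix M M ℂ) ⊗ₖ Z i - (V i : Matrix (M × B) (M × B) ℂ)ᴴ
        * ((1 : Matrix M M ℂ) ⊗ₖ Z (i + 1)) * (V i : Matrix (M × B) (M × B) ℂ)).PosSemidef) :
    prob (evolve U V ψ₀ (k + 1)) (W k ⊗ₖ ((1 : Matrix M M ℂ) ⊗ₖ Z (k + 1)))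
      ≤ prob (tensorLeft (U 0 : Matrix (A × M) (A × M) ℂ) (1 : Matrix B B ℂ) *ᵥ ψ₀)
          (W 0 ⊗ₖ ((1 : Matrix M M ℂ) ⊗ₖ Z 0)) := by
  -- Bob's move leaves Alice's space alone, so the inequality for `Z` may be tensored with `W i ≥
  -- 0`; `hstepU` is the mirror image. The index of `Z` is one ahead of that of `W` because Alice's
  -- first move precedes the start of her certificate.
  have hstepV : ∀ i ≤ k, prob (evolve U V ψ₀ (i + 1)) (W i ⊗ₖ ((1 : Matrix M M ℂ) ⊗ₖ Z (i + 1)))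
      ≤ prob (tensorLeft (U i : Matrix (A × M) (A × M) ℂ) (1 : Matrix B B ℂ) *ᵥ evolve U V ψ₀ i)
          (W i ⊗ₖ ((1 : Matrix M M ℂ) ⊗ₖ Z i)) := by
    intro i hi
    rw [evolve, prob_mulVec]
    refine prob_mono _ ?_
    have h := (hW i hi).kronecker (hZV i (by omega))
    rw [Matrix.conjTranspose_kronecker, ← Matrix.mul_kronecker_mul, ← Matrix.mul_kronecker_mul]
    simpa [kronecker_sub] using h
  have hstepU : ∀ i < k,
      prob (tensorLeft (U (i + 1) : Matrix (A × M) (A × M) ℂ) (1 : Matrix B B ℂ)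
        *ᵥ evolve U V ψ₀ (i + 1)) (W (i + 1) ⊗ₖ ((1 : Matrix M M ℂ) ⊗ₖ Z (i + 1)))
      ≤ prob (evolve U V ψ₀ (i + 1)) (W i ⊗ₖ ((1 : Matrix M M ℂ) ⊗ₖ Z (i + 1))) := by
    intro i hi
    rw [prob_mulVec]
    refine prob_mono _ ?_
    have h := tensorLeft_posSemidef (hWU i hi) (hZ (i + 1) (by omega))
    rw [← tensorLeft_kronecker, ← tensorLeft_kronecker, tensorLeft_conjTranspose, tensorLeft_mul,
      tensorLeft_mul]
    simpa [tensorLeft_sub] using h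
  have hchain : ∀ i ≤ k, prob (evolve U V ψ₀ (i + 1)) (W i ⊗ₖ ((1 : Matrix M M ℂ) ⊗ₖ Z (i + 1)))
      ≤ prob (tensorLeft (U 0 : Matrix (A × M) (A × M) ℂ) (1 : Matrix B B ℂ) *ᵥ ψ₀)
          (W 0 ⊗ₖ ((1 : Matrix M M ℂ) ⊗ₖ Z 0)) := by
    intro i
    induction i with
    | zero => exact fun _ => hstepV 0 (by omega)
    | succ i ih =>
      exact fun hi => (hstepV (i + 1) hi).trans ((hstepU i (by omega)).trans (ih (by omega)))
  exact hchain k le_rfl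

/-- If no cheating Alice wins her game with probability more than `a`, and no cheating Bob his game
with probability more than `v`, then the honest parties agree with probability at most `v * a`. -/
theorem honest_le_mul [Nonempty C] [Nonempty O] (α : A → ℂ) (m₀ : M) (β : B → ℂ) (n : ℕ)
    (U : ℕ → Matrix.unitaryGroup (A × M) ℂ) (V : ℕ → Matrix.unitaryGroup (M × B) ℂ)
    {F : C → O → Matrix A A ℂ} {Q : C → O → Matrix B B ℂ} (hF : ∀ c o, (F c o).PosSemidef)
    (hQ : ∀ c o, (Q c o).PosSemidef) {a v : ℝ}
    (hAlice : ∀ (K : Type) (_ : Fintype K) (_ : DecidableEq K) (S : CheatingAlice C K M),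
      ∑ c, prob (evolve S.unitary V (prodVec (Pi.single S.start 1) m₀ β) n)
        (tensorLeft (S.guess.op c) (∑ o, Q c o)) ≤ a)
    (hBob : ∀ (K : Type) (_ : Fintype K) (_ : DecidableEq K) (b : K)
      (T : ℕ → Matrix.unitaryGroup (M × K) ℂ) (G : C → POVM O (M × K)),
      (∀ c, (G c).IsProjective) →
      ∑ c, ∑ o, prob (evolve U T (prodVec α m₀ (Pi.single b 1)) n) (F c o ⊗ₖ (G c).op o) ≤ v) :
    ∑ c, ∑ o, prob (evolve U V (prodVec α m₀ β) n) (F c o ⊗ₖ ((1 : Matrix M M ℂ) ⊗ₖ Q c o))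
      ≤ v * a := by
  have key : ∀ v' > v, ∀ a' > a,
      ∑ c, ∑ o, prob (evolve U V (prodVec α m₀ β) n) (F c o ⊗ₖ ((1 : Matrix M M ℂ) ⊗ₖ Q c o))
        ≤ v' * a' := by
    intro v' hv' a' ha'
    have hQs : ∀ c, (∑ o, Q c o).PosSemidef := fun c => posSemidef_sum _ fun o _ => hQ c o
    -- Alice faces no question, and her answer is `c`; Bob faces the question `c`. So `Z n`
    -- dominates every `∑ o, Q c o`, while Bob's final operator is the sum of the `Y c`, each
    -- dominating all `F c o`.
    obtain ⟨Z, X, hZ, hZV, hZn, hZE, hZ0⟩ := exists_cheater_dual (C := Unit) (O := C) (n := n)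
      m₀ V (tens (Pi.single m₀ 1) β) (E := fun _ c => ∑ o, Q c o) (fun _ c => hQs c) ha'
      (fun K _ _ k S G _ => by
        simpa [prodVec] using hAlice K inferInstance inferInstance ⟨k, S, G ()⟩)
    have hZX : Z n = X () := by simpa using hZn
    have hfin : ∀ (Y : C → Matrix A A ℂ), (∀ c o, (Y c - F c o).PosSemidef) →
        ∑ c, ∑ o, prob (evolve U V (prodVec α m₀ β) n) (F c o ⊗ₖ ((1 : Matrix M M ℂ) ⊗ₖ Q c o))
          ≤ prob (evolve U V (prodVec α m₀ β) n) ((∑ c, Y c) ⊗ₖ ((1 : Matrix M M ℂ) ⊗ₖ Z n)) := by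
      intro Y hY
      have hYp : ∀ c, (Y c).PosSemidef := fun c => by
        have := (hY c (Classical.arbitrary O)).add (hF c (Classical.arbitrary O))
        rwa [sub_add_cancel] at this
      rw [sum_kronecker, prob_sum]
      refine Finset.sum_le_sum fun c _ => ?_
      calc ∑ o, prob (evolve U V (prodVec α m₀ β) n) (F c o ⊗ₖ ((1 : Matrix M M ℂ) ⊗ₖ Q c o))
          ≤ ∑ o, prob (evolve U V (prodVec α m₀ β) n) (Y c ⊗ₖ ((1 : Matrix M M ℂ) ⊗ₖ Q c o)) := by
            refine Finset.sum_le_sum fun o _ => prob_mono _ ?_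
            rw [← sub_kronecker]
            exact (hY c o).kronecker (Matrix.PosSemidef.one.kronecker (hQ c o))
        _ = prob (evolve U V (prodVec α m₀ β) n)
              (Y c ⊗ₖ ((1 : Matrix M M ℂ) ⊗ₖ ∑ o, Q c o)) := by
            rw [kronecker_sum, kronecker_sum, prob_sum]
        _ ≤ _ := by
            refine prob_mono _ ?_
            rw [← kronecker_sub, ← kronecker_sub, hZX]
            exact (hYp c).kronecker (Matrix.PosSemidef.one.kronecker (hZE () c))
    have hβ : prob (tens (Pi.single m₀ 1) β) ((1 : Matrix M M ℂ) ⊗ₖ Z 0) = prob β (Z 0) := by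
      rw [prob_one_kronecker, red_tens_single, trace_mul_red_of_vecMulVec]
    rw [hβ] at hZ0
    have hprod : ∀ (θ : A × M → ℂ) (W : Matrix A A ℂ), W.PosSemidef →
        prob θ (W ⊗ₖ (1 : Matrix M M ℂ)) < v' →
        prob (tens θ β) ((W ⊗ₖ (1 : Matrix M M ℂ)) ⊗ₖ Z 0) ≤ v' * a' := by
      intro θ W hW hlt
      have hW1 := hW.kronecker (Matrix.PosSemidef.one (n := M) (R := ℂ))
      rw [prob_tens _ _ _ hW1.isHermitian]
      have h1 := prob_nonneg θ hW1
      have h2 := prob_nonneg β (hZ 0 (by omega))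
      exact mul_le_mul hlt.le hZ0.le h2 (h1.trans hlt.le)
    cases n with
    | zero =>
      obtain ⟨Y, hYp, hY, hY0⟩ := exists_bob_dual_zero α m₀ hF hv' (fun K _ _ b G hG =>
        hBob K inferInstance inferInstance b (fun _ => 1) G hG)
      refine (hfin Y hY).trans ?_
      rw [evolve, ← tensorLeft_kronecker, prob_tensorLeft, grp_prodVec]
      exact hprod _ _ hYp hY0
    | succ k =>
      obtain ⟨W, Y, hW, hWU, hWk, hY, hW0⟩ := exists_bob_dual α m₀ U k hF hv' hBob
      refine (hfin Y hY).trans ?_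
      rw [← hWk]
      refine (prob_evolve_le _ hW hZ hWU hZV).trans ?_
      rw [← tensorLeft_kronecker, prob_tensorLeft, grp_tensorLeft_mulVec, grp_prodVec,
        kronecker_mulVec_tens, Matrix.one_mulVec]
      exact hprod _ _ (hW 0 (by omega)) hW0
  have hlim : Filter.Tendsto (fun ε : ℝ => (v + ε) * (a + ε)) (nhdsWithin 0 (Set.Ioi 0))
      (nhds (v * a)) := by
    have : Continuous fun ε : ℝ => (v + ε) * (a + ε) := by fun_prop
    have h := this.tendsto 0
    simp only [add_zero] at h
    exact h.mono_left nhdsWithin_le_nhds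
  refine ge_of_tendsto hlim ?_
  filter_upwards [self_mem_nhdsWithin] with ε hε
  have hε' : 0 < ε := hε
  exact key _ (by linarith) _ (by linarith)

end Kitaev

/-! ### Learning two bits in sequence -/

section Sequential

/-- Two projections that each almost fix a vector `Φ` of norm at most one: applying them one after
the other, in one of the two orders, does not shorten `Φ` much. -/
theorem sequential_projections {E : Type*} [NormedAddCommGroup E] [InnerProductSpace ℂ E]
    (S T : E →ₗ[ℂ] E) (hS : S.IsSymmetric) (hT : T.IsSymmetric) (hSS : ∀ x, S (S x) = S x)
    (hTT : ∀ x, T (T x) = T x) {Φ : E} (hΦ : ‖Φ‖ ≤ 1) (h : 1 ≤ ‖S Φ‖ ^ 2 + ‖T Φ‖ ^ 2) :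
    (‖S Φ‖ ^ 2 + ‖T Φ‖ ^ 2) * (‖S Φ‖ ^ 2 + ‖T Φ‖ ^ 2 - 1) ^ 2
      ≤ ‖T (S Φ)‖ ^ 2 + ‖S (T Φ)‖ ^ 2 := by
  have hproj : ∀ R : E →ₗ[ℂ] E, R.IsSymmetric → (∀ x, R (R x) = R x) →
      RCLike.re (inner ℂ Φ (R Φ)) = ‖R Φ‖ ^ 2 := by
    intro R hR hRR
    have : inner ℂ Φ (R Φ) = inner ℂ (R Φ) (R Φ) := by rw [hR, hRR]
    rw [this, inner_self_eq_norm_sq]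
  set p := ‖S Φ‖ with hp
  set q := ‖T Φ‖ with hq
  have hp0 : 0 ≤ p := norm_nonneg _
  have hq0 : 0 ≤ q := norm_nonneg _
  set r := RCLike.re (inner ℂ (S Φ) (T Φ)) with hr
  -- Cauchy–Schwarz for `Φ` and `S Φ + T Φ`, whose inner product has real part `p² + q²`; expanding
  -- `‖S Φ + T Φ‖²` brings in the overlap `r`.
  have hsum : (p ^ 2 + q ^ 2) * (p ^ 2 + q ^ 2 - 1) ≤ 2 * r := by
    have h1 : p ^ 2 + q ^ 2 ≤ ‖S Φ + T Φ‖ := by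
      calc p ^ 2 + q ^ 2 = RCLike.re (inner ℂ Φ (S Φ + T Φ)) := by
            rw [inner_add_right, map_add, hproj S hS hSS, hproj T hT hTT]
        _ ≤ ‖Φ‖ * ‖S Φ + T Φ‖ := re_inner_le_norm _ _
        _ ≤ 1 * ‖S Φ + T Φ‖ := mul_le_mul_of_nonneg_right hΦ (norm_nonneg _)
        _ = _ := one_mul _
    have h2 : ‖S Φ + T Φ‖ ^ 2 = p ^ 2 + 2 * r + q ^ 2 := norm_add_sq _ _
    have h3 : (p ^ 2 + q ^ 2) ^ 2 ≤ ‖S Φ + T Φ‖ ^ 2 := pow_le_pow_left₀ (by positivity) h1 2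
    nlinarith
  -- Since `T` is a projection, the overlap of `S Φ` with `T Φ` is that of `T (S Φ)` with `T Φ`.
  have hTS : r ≤ ‖T (S Φ)‖ * q := by
    have : inner ℂ (S Φ) (T Φ) = inner ℂ (T (S Φ)) (T Φ) := by rw [hT, hTT]
    rw [hr, this]
    exact re_inner_le_norm _ _
  have hST : r ≤ p * ‖S (T Φ)‖ := by
    have : inner ℂ (S Φ) (T Φ) = inner ℂ (S Φ) (S (T Φ)) := by rw [← hS, hSS]
    rw [hr, this]
    exact re_inner_le_norm _ _
  set x := ‖T (S Φ)‖
  set y := ‖S (T Φ)‖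
  have hr0 : 0 ≤ r := by
    have : 0 ≤ (p ^ 2 + q ^ 2) * (p ^ 2 + q ^ 2 - 1) := by
      apply mul_nonneg (by positivity); linarith
    linarith
  have hx0 : 0 ≤ x := norm_nonneg _
  have hy0 : 0 ≤ y := norm_nonneg _
  set s := p ^ 2 + q ^ 2 with hs
  have hs0 : 0 < s := by linarith
  have hr2 : (s * (s - 1)) ^ 2 ≤ 4 * r ^ 2 := by
    have : 0 ≤ s * (s - 1) := mul_nonneg hs0.le (by linarith)
    nlinarith
  have hx2 : r ^ 2 ≤ x ^ 2 * q ^ 2 := by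
    rw [← mul_pow]; exact pow_le_pow_left₀ hr0 hTS 2
  have hy2 : r ^ 2 ≤ p ^ 2 * y ^ 2 := by
    rw [← mul_pow]; exact pow_le_pow_left₀ hr0 hST 2
  have hpq : 4 * (p ^ 2 * q ^ 2) ≤ s ^ 2 := by
    rw [hs]; nlinarith [sq_nonneg (p ^ 2 - q ^ 2)]
  -- This is `x² + y² ≥ r² (1/p² + 1/q²)` with denominators cleared, since `p` or `q` may vanish.
  have h1 : r ^ 2 * s ≤ p ^ 2 * q ^ 2 * (x ^ 2 + y ^ 2) := by
    rw [hs]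
    nlinarith [mul_le_mul_of_nonneg_left hx2 (sq_nonneg p), mul_le_mul_of_nonneg_left hy2 (sq_nonneg q)]
  have h2 : (s * (s - 1)) ^ 2 * s ≤ s ^ 2 * (x ^ 2 + y ^ 2) := by
    calc (s * (s - 1)) ^ 2 * s ≤ 4 * r ^ 2 * s := mul_le_mul_of_nonneg_right hr2 hs0.le
      _ ≤ 4 * (p ^ 2 * q ^ 2) * (x ^ 2 + y ^ 2) := by linarith
      _ ≤ _ := mul_le_mul_of_nonneg_right hpq (by positivity)
  have h3 : s ^ 2 * (s * (s - 1) ^ 2) ≤ s ^ 2 * (x ^ 2 + y ^ 2) := by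
    calc s ^ 2 * (s * (s - 1) ^ 2) = (s * (s - 1)) ^ 2 * s := by ring
      _ ≤ _ := h2
  exact le_of_mul_le_mul_left h3 (by positivity)

theorem norm_toLp_sq {H : Type} [Fintype H] [DecidableEq H] (v : H → ℂ) :
    ‖(WithLp.toLp 2 v : EuclideanSpace ℂ H)‖ ^ 2 = prob v 1 := by
  rw [EuclideanSpace.norm_sq_eq, prob_one]

theorem sequential_projections_matrix {H : Type} [Fintype H] [DecidableEq H]
    {S T : Matrix H H ℂ} (hS : S.IsHermitian) (hT : T.IsHermitian) (hSS : S * S = S)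
    (hTT : T * T = T) {Φ : H → ℂ} (hΦ : prob Φ 1 ≤ 1)
    (h : 1 ≤ prob (S *ᵥ Φ) 1 + prob (T *ᵥ Φ) 1) :
    (prob (S *ᵥ Φ) 1 + prob (T *ᵥ Φ) 1) * (prob (S *ᵥ Φ) 1 + prob (T *ᵥ Φ) 1 - 1) ^ 2
      ≤ prob (T *ᵥ S *ᵥ Φ) 1 + prob (S *ᵥ T *ᵥ Φ) 1 := by
  have hidem : ∀ {R : Matrix H H ℂ}, R * R = R → ∀ x : EuclideanSpace ℂ H,
      Matrix.toEuclideanLin R (Matrix.toEuclideanLin R x) = Matrix.toEuclideanLin R x := by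
    intro R hR x
    simp [Matrix.toLpLin_apply, Matrix.mulVec_mulVec, hR]
  have := sequential_projections (Matrix.toEuclideanLin S) (Matrix.toEuclideanLin T)
    (Matrix.isSymmetric_toEuclideanLin_iff.2 hS) (Matrix.isSymmetric_toEuclideanLin_iff.2 hT)
    (hidem hSS) (hidem hTT) (Φ := WithLp.toLp 2 Φ)
  simp only [Matrix.toLpLin_apply, norm_toLp_sq] at this
  refine this ?_ h
  rw [← norm_toLp_sq] at hΦ
  exact (sq_le_one_iff₀ (norm_nonneg _)).1 hΦ

variable {A K X : Type} [Fintype A] [DecidableEq A] [Fintype K] [DecidableEq K]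
  [Fintype X] [DecidableEq X]

theorem prob_prod_one {H : Type} [Fintype H] [DecidableEq H] (v : H × X → ℂ) :
    prob v 1 = ∑ x, prob (fun h => v (h, x)) 1 := by
  simp only [prob_one, Fintype.sum_prod_type]
  exact Finset.sum_comm

theorem blockDiagonal_mulVec_apply {H : Type} [Fintype H] [DecidableEq H] (D : X → Matrix H H ℂ)
    (v : H × X → ℂ) (p : H × X) :
    (Matrix.blockDiagonal D *ᵥ v) p = (D p.2 *ᵥ fun h => v (h, p.2)) p.1 := by
  simp only [Matrix.mulVec, dotProduct, Fintype.sum_prod_type]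
  refine Finset.sum_congr rfl fun h _ => ?_
  rw [Finset.sum_eq_single p.2]
  · simp [Matrix.blockDiagonal_apply]
  · intro x _ hx
    simp [Matrix.blockDiagonal_apply, hx.symm]
  · simp

/-- The measurement `E` followed by the measurement `F`. -/
def POVM.andThen {O O' : Type} [Fintype O] [Fintype O'] (E : POVM O K) (hE : E.IsProjective)
    (F : POVM O' K) : POVM (O × O') K where
  op x := E.op x.1 * F.op x.2 * E.op x.1
  posSemidef x := by
    have := (F.posSemidef x.2).conjTranspose_mul_mul_same (E.op x.1)
    rwa [(E.posSemidef x.1).isHermitian] at this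
  sum_eq_one := by
    rw [Fintype.sum_prod_type]
    have : ∀ o, ∑ o', E.op o * F.op o' * E.op o = E.op o := fun o => by
      rw [← Finset.sum_mul, ← Finset.mul_sum, F.sum_eq_one, Matrix.mul_one, hE.mul_self]
    simp only [this, E.sum_eq_one]

/-- Reordering the outcomes of a measurement. -/
def POVM.permute {O O' : Type} [Fintype O] [Fintype O'] (E : POVM O K) (e : O' ≃ O) :
    POVM O' K where
  op x := E.op (e x)
  posSemidef x := E.posSemidef _
  sum_eq_one := by rw [e.sum_comp (fun o => E.op o), E.sum_eq_one]

/-- If the two bits of `x` can each be guessed well, by projective measurements, then both can be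
guessed together. -/
theorem exists_povm_guess_both {P : Bool × Bool → Matrix A A ℂ} (hP : ∀ x, (P x).PosSemidef)
    (hP1 : (1 - ∑ x, P x).PosSemidef) {ψ : A × K → ℂ} (hψ : prob ψ 1 ≤ 1)
    {E F : POVM Bool K} (hE : E.IsProjective) (hF : F.IsProjective) {a : ℝ}
    (ha : 2 * a = ∑ x, prob ψ (P x ⊗ₖ E.op x.1) + ∑ x, prob ψ (P x ⊗ₖ F.op x.2))
    (ha' : 1 / 2 ≤ a) :
    ∃ G : POVM (Bool × Bool) K, g a ≤ ∑ x, prob ψ (P x ⊗ₖ G.op x) := by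
  choose R hR using fun x => exists_eq_conjTranspose_mul_self (hP x)
  -- Alice's output is recorded coherently in an extra register. Then "the guess of the first bit is
  -- right" and "the guess of the second bit is right" become single projections `S` and `T`, block
  -- diagonal in that register; `hP1` gives `‖Φ‖ ≤ 1`.
  let Φ : (A × K) × (Bool × Bool) → ℂ := fun p => ((R p.2 ⊗ₖ (1 : Matrix K K ℂ)) *ᵥ ψ) p.1
  let S : Matrix ((A × K) × (Bool × Bool)) ((A × K) × (Bool × Bool)) ℂ :=
    Matrix.blockDiagonal fun x => (1 : Matrix A A ℂ) ⊗ₖ E.op x.1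
  let T : Matrix ((A × K) × (Bool × Bool)) ((A × K) × (Bool × Bool)) ℂ :=
    Matrix.blockDiagonal fun x => (1 : Matrix A A ℂ) ⊗ₖ F.op x.2
  have hherm : ∀ D : Bool × Bool → Matrix K K ℂ, (∀ x, (D x).IsHermitian) →
      (Matrix.blockDiagonal fun x => (1 : Matrix A A ℂ) ⊗ₖ D x).IsHermitian := by
    intro D hD
    rw [Matrix.IsHermitian, Matrix.blockDiagonal_conjTranspose]
    congr 1
    funext x
    rw [Matrix.conjTranspose_kronecker, Matrix.conjTranspose_one, hD]
  have hidem : ∀ D : Bool × Bool → Matrix K K ℂ, (∀ x, D x * D x = D x) →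
      (Matrix.blockDiagonal fun x => (1 : Matrix A A ℂ) ⊗ₖ D x)
        * (Matrix.blockDiagonal fun x => (1 : Matrix A A ℂ) ⊗ₖ D x)
        = Matrix.blockDiagonal fun x => (1 : Matrix A A ℂ) ⊗ₖ D x := by
    intro D hD
    rw [← Matrix.blockDiagonal_mul]
    congr 1
    funext x
    rw [← Matrix.mul_kronecker_mul, Matrix.one_mul, hD]
  have hval : ∀ D : Bool × Bool → Matrix K K ℂ,
      prob ((Matrix.blockDiagonal fun x => (1 : Matrix A A ℂ) ⊗ₖ D x) *ᵥ Φ) 1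
        = ∑ x, prob ψ (P x ⊗ₖ ((D x)ᴴ * D x)) := by
    intro D
    rw [prob_prod_one]
    refine Finset.sum_congr rfl fun x _ => ?_
    have e : (fun h => ((Matrix.blockDiagonal fun x => (1 : Matrix A A ℂ) ⊗ₖ D x) *ᵥ Φ) (h, x))
        = (R x ⊗ₖ D x) *ᵥ ψ := by
      funext h
      rw [blockDiagonal_mulVec_apply]
      have : (fun h => Φ (h, x)) = (R x ⊗ₖ (1 : Matrix K K ℂ)) *ᵥ ψ := rfl
      simp only [this]
      rw [Matrix.mulVec_mulVec, ← Matrix.mul_kronecker_mul, Matrix.one_mul, Matrix.mul_one]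
    rw [e, prob_mulVec, Matrix.mul_one, Matrix.conjTranspose_kronecker, ← Matrix.mul_kronecker_mul,
      ← hR]
  have hproj : ∀ D : Bool × Bool → Matrix K K ℂ, (∀ x, (D x).IsHermitian) →
      (∀ x, D x * D x = D x) →
      prob ((Matrix.blockDiagonal fun x => (1 : Matrix A A ℂ) ⊗ₖ D x) *ᵥ Φ) 1
        = ∑ x, prob ψ (P x ⊗ₖ D x) := by
    intro D hD hDD
    rw [hval]
    simp only [(hD _).eq, hDD]
  have hSv := hproj (fun x => E.op x.1) (fun x => (E.posSemidef _).isHermitian)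
    fun x => hE.mul_self _
  have hTv := hproj (fun x => F.op x.2) (fun x => (F.posSemidef _).isHermitian)
    fun x => hF.mul_self _
  have hcomp : ∀ D D' : Bool × Bool → Matrix K K ℂ, (∀ x, (D x).IsHermitian) →
      (∀ x, (D' x).IsHermitian) → (∀ x, D' x * D' x = D' x) →
      prob ((Matrix.blockDiagonal fun x => (1 : Matrix A A ℂ) ⊗ₖ D' x) *ᵥ
        (Matrix.blockDiagonal fun x => (1 : Matrix A A ℂ) ⊗ₖ D x) *ᵥ Φ) 1
        = ∑ x, prob ψ (P x ⊗ₖ (D x * D' x * D x)) := by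
    intro D D' hD hD' hDD'
    rw [Matrix.mulVec_mulVec, ← Matrix.blockDiagonal_mul]
    simp only [← Matrix.mul_kronecker_mul, Matrix.one_mul]
    rw [hval]
    refine Finset.sum_congr rfl fun x _ => ?_
    rw [Matrix.conjTranspose_mul, hD, hD', Matrix.mul_assoc, ← Matrix.mul_assoc (D' x), hDD',
      Matrix.mul_assoc]
  have hTS := hcomp (fun x => E.op x.1) (fun x => F.op x.2)
    (fun x => (E.posSemidef _).isHermitian) (fun x => (F.posSemidef _).isHermitian)
    (fun x => hF.mul_self _)
  have hST := hcomp (fun x => F.op x.2) (fun x => E.op x.1)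
    (fun x => (F.posSemidef _).isHermitian) (fun x => (E.posSemidef _).isHermitian)
    (fun x => hE.mul_self _)
  have hΦ : prob Φ 1 ≤ 1 := by
    have h := hval fun _ => 1
    have e : (Matrix.blockDiagonal fun _ : Bool × Bool => (1 : Matrix A A ℂ) ⊗ₖ (1 : Matrix K K ℂ))
        = 1 := by
      simp only [Matrix.one_kronecker_one]
      exact Matrix.blockDiagonal_one
    rw [e, Matrix.one_mulVec] at h
    simp only [Matrix.conjTranspose_one, Matrix.one_mul] at h
    rw [h, ← prob_sum]
    refine (prob_mono ψ (F := 1) ?_).trans hψ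
    have h1 := hP1.kronecker (Matrix.PosSemidef.one (n := K) (R := ℂ))
    rwa [sub_kronecker, Matrix.one_kronecker_one, sum_kronecker] at h1
  have hmain := sequential_projections_matrix (S := S) (T := T)
    (hherm _ fun x => (E.posSemidef _).isHermitian) (hherm _ fun x => (F.posSemidef _).isHermitian)
    (hidem _ fun x => hE.mul_self _) (hidem _ fun x => hF.mul_self _) hΦ
    (by rw [hSv, hTv]; linarith)
  rw [hSv, hTv, hTS, hST, ← ha] at hmain
  -- The two orders together succeed with at least `2 * g a`, so one of them reaches `g a`.
  by_cases hcase : g a ≤ ∑ x, prob ψ (P x ⊗ₖ (E.op x.1 * F.op x.2 * E.op x.1))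
  · exact ⟨E.andThen hE F, hcase⟩
  · refine ⟨(F.andThen hF E).permute (Equiv.prodComm _ _), ?_⟩
    have hg : 2 * g a = 2 * a * (2 * a - 1) ^ 2 := by unfold g; ring
    show g a ≤ ∑ x, prob ψ (P x ⊗ₖ (F.op x.2 * E.op x.1 * F.op x.2))
    linarith

end Sequential

/-! ### The product bound for protocols that start in a product vector -/

section General

variable {A M B : Type} [Fintype A] [DecidableEq A] [Fintype M] [DecidableEq M]
  [Fintype B] [DecidableEq B]

theorem smul_kronecker_real {J L : Type} (r : ℝ) (X : Matrix J J ℂ) (Y : Matrix L L ℂ) :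
    (r • X) ⊗ₖ Y = r • (X ⊗ₖ Y) := by
  ext p q
  simp [mul_assoc]

/-- Half the effect that the bit `x_c` of Alice's output is `y`. -/
noncomputable def bitEffect (P : Bool × Bool → Matrix A A ℂ) (c y : Bool) : Matrix A A ℂ :=
  (1 / 2 : ℝ) • ∑ x, if bitAt x c = y then P x else 0

theorem bitEffect_posSemidef {P : Bool × Bool → Matrix A A ℂ} (hP : ∀ x, (P x).PosSemidef)
    (c y : Bool) : (bitEffect P c y).PosSemidef := by
  refine (posSemidef_sum _ fun x _ => ?_).smul (by norm_num)
  split_ifs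
  · exact hP x
  · exact Matrix.PosSemidef.zero

/-- The factor 1/2 is the probability of the question `c`. For Bob's answers the sum is his average
success; for the honest outputs it is half the probability that they are consistent. -/
theorem sum_prob_bitEffect {L : Type} [Fintype L] (P : Bool × Bool → Matrix A A ℂ)
    (X : Bool → Bool → Matrix L L ℂ) (ψ : A × L → ℂ) :
    ∑ c, ∑ y, prob ψ (bitEffect P c y ⊗ₖ X c y)
      = 1 / 2 * ∑ c, ∑ x, prob ψ (P x ⊗ₖ X c (bitAt x c)) := by
  rw [Finset.mul_sum]
  refine Finset.sum_congr rfl fun c _ => ?_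
  have h : ∀ y, prob ψ (bitEffect P c y ⊗ₖ X c y)
      = 1 / 2 * ∑ x, if bitAt x c = y then prob ψ (P x ⊗ₖ X c y) else 0 := by
    intro y
    rw [bitEffect, smul_kronecker_real, prob_smul, sum_kronecker, prob_sum]
    congr 1
    refine Finset.sum_congr rfl fun x _ => ?_
    split_ifs
    · rfl
    · rw [Matrix.zero_kronecker, prob_zero]
  simp only [h]
  rw [← Finset.mul_sum, Finset.sum_comm]
  congr 1
  exact Finset.sum_congr rfl fun x _ => by simp

theorem prob_prodVec_one (α : A → ℂ) (m₀ : M) (β : B → ℂ) :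
    prob (prodVec α m₀ β) 1 = prob α 1 * prob β 1 := by
  rw [prodVec, ← Matrix.one_kronecker_one, prob_tens _ _ _ Matrix.isHermitian_one,
    ← Matrix.one_kronecker_one, prob_tens _ _ _ Matrix.isHermitian_one]
  have : prob (Pi.single m₀ 1 : M → ℂ) 1 = 1 := by simp [prob]
  rw [this, one_mul]

/-- The product bound, for bounds `a` and `b` on the cheating probabilities. -/
theorem half_le_mul_f {α : A → ℂ} (hα : prob α 1 = 1) (m₀ : M) (β : B → ℂ) (n : ℕ)
    (U : ℕ → Matrix.unitaryGroup (A × M) ℂ) (V : ℕ → Matrix.unitaryGroup (M × B) ℂ)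
    {P : Bool × Bool → Matrix A A ℂ} (hP : ∀ x, (P x).PosSemidef)
    (hP1 : (1 - ∑ x, P x).PosSemidef) {Q : Bool → Bool → Matrix B B ℂ}
    (hQ : ∀ c y, (Q c y).PosSemidef) {a b : ℝ} (hb : b ∈ Set.Icc (1 / 2 : ℝ) 1)
    (hAlice : ∀ (K : Type) (_ : Fintype K) (_ : DecidableEq K) (S : CheatingAlice Bool K M),
      ∑ c, prob (evolve S.unitary V (prodVec (Pi.single S.start 1) m₀ β) n)
        (tensorLeft (S.guess.op c) (∑ y, Q c y)) ≤ a)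
    (hBob : ∀ (K : Type) (_ : Fintype K) (_ : DecidableEq K) (S : CheatingBob (Bool × Bool) M K),
      ∑ x, prob (evolve U S.unitary (prodVec α m₀ (Pi.single S.start 1)) n)
        (P x ⊗ₖ S.guess.op x) ≤ b)
    (honest : ∑ c, ∑ x, prob (evolve U V (prodVec α m₀ β) n)
      (P x ⊗ₖ ((1 : Matrix M M ℂ) ⊗ₖ Q c (bitAt x c))) = 1) :
    1 / 2 ≤ a * f b := by
  have h := honest_le_mul α m₀ β n U V (bitEffect_posSemidef hP) hQ (v := f b) hAlice
    (fun K _ _ b₀ T G hG => by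
      rw [sum_prob_bitEffect P (fun c y => (G c).op y)]
      -- Bob's average success in guessing `x_c` is at most `f b`: otherwise guessing both bits in
      -- sequence would beat `b`.
      refine le_f ⟨by linarith [hb.1], hb.2⟩ fun hhalf => ?_
      have hnorm : prob (evolve U T (prodVec α m₀ (Pi.single b₀ 1)) n) 1 ≤ 1 := by
        rw [prob_evolve_one, prob_prodVec_one, hα]
        simp [prob]
      obtain ⟨G', hG'⟩ := exists_povm_guess_both hP hP1 hnorm (hG false) (hG true)
        (by rw [Fintype.sum_bool]; simp only [bitAt]; norm_num; ring) hhalf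
      exact hG'.trans (hBob K inferInstance inferInstance ⟨b₀, T, G'⟩))
  rw [sum_prob_bitEffect P (fun c y => (1 : Matrix M M ℂ) ⊗ₖ Q c y), honest] at h
  linarith

end General

/-! ### Elementary bounds on cheating probabilities -/

section Bounds

variable {A M B O : Type} [Fintype A] [DecidableEq A] [Fintype M] [DecidableEq M]
  [Fintype B] [DecidableEq B] [Fintype O] [DecidableEq O]

theorem POVM.one_sub_sum_posSemidef (E : POVM O A) (s : Finset O) :
    (1 - ∑ o ∈ s, E.op o).PosSemidef := by
  rw [← E.sum_eq_one, ← Finset.sum_compl_add_sum s, add_sub_cancel_right]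
  exact posSemidef_sum _ fun o _ => E.posSemidef o

theorem prob_run_one (U : ℕ → Matrix.unitaryGroup (A × M) ℂ)
    (V : ℕ → Matrix.unitaryGroup (M × B) ℂ) (a : A) (m : M) (b : B) (n : ℕ) :
    prob (run U V a m b n) 1 = 1 := by
  rw [run_eq_evolve, prob_evolve_one]
  simp [prob]

theorem single_eq_prodVec (a : A) (m : M) (b : B) :
    (Pi.single (a, m, b) 1 : A × M × B → ℂ) = prodVec (Pi.single a 1) m (Pi.single b 1) := by
  rw [prodVec, tens_single_single, tens_single_single]

/-- A party that guesses by the measurement `G` is right with probability at most one. -/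
theorem sum_prob_tensorLeft_le {ψ : A × M × B → ℂ} (hψ : prob ψ 1 = 1) (G : POVM O (A × M))
    {E : O → Matrix B B ℂ} (hE : ∀ o, (1 - E o).PosSemidef) :
    ∑ o, prob ψ (tensorLeft (G.op o) (E o)) ≤ 1 := by
  calc ∑ o, prob ψ (tensorLeft (G.op o) (E o))
      ≤ ∑ o, prob (grp ψ) (G.op o ⊗ₖ (1 : Matrix B B ℂ)) := by
        refine Finset.sum_le_sum fun o _ => ?_
        rw [prob_tensorLeft]
        refine prob_mono _ ?_
        rw [← kronecker_sub]
        exact (G.posSemidef o).kronecker (hE o)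
    _ = prob ψ 1 := by
        rw [← prob_sum, ← sum_kronecker, G.sum_eq_one, ← prob_tensorLeft, tensorLeft_one]
    _ = 1 := hψ

theorem sum_prob_kronecker_le {K : Type} [Fintype K] [DecidableEq K] {ψ : A × K → ℂ}
    (hψ : prob ψ 1 = 1) (G : POVM O K) {P : O → Matrix A A ℂ} (hP : ∀ o, (1 - P o).PosSemidef) :
    ∑ o, prob ψ (P o ⊗ₖ G.op o) ≤ 1 := by
  calc ∑ o, prob ψ (P o ⊗ₖ G.op o) ≤ ∑ o, prob ψ ((1 : Matrix A A ℂ) ⊗ₖ G.op o) := by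
        refine Finset.sum_le_sum fun o _ => prob_mono _ ?_
        rw [← sub_kronecker]
        exact (hP o).kronecker (G.posSemidef o)
    _ = prob ψ 1 := by
        rw [← prob_sum, ← kronecker_sum, G.sum_eq_one, Matrix.one_kronecker_one]
    _ = 1 := hψ

theorem sum_prob_tensorLeft {ι : Type} (s : Finset ι) (ψ : A × M × B → ℂ)
    (X : Matrix (A × M) (A × M) ℂ) (Y : ι → Matrix B B ℂ) :
    ∑ i ∈ s, prob ψ (tensorLeft X (Y i)) = prob ψ (tensorLeft X (∑ i ∈ s, Y i)) := by
  simp only [prob_tensorLeft, kronecker_sum, prob_sum]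

/-- A measurement of Bob's private space as a measurement that ignores the message. -/
def POVM.ignoreMessage (E : POVM O B) : POVM O (M × B) where
  op o := (1 : Matrix M M ℂ) ⊗ₖ E.op o
  posSemidef o := Matrix.PosSemidef.one.kronecker (E.posSemidef o)
  sum_eq_one := by rw [← kronecker_sum, E.sum_eq_one, Matrix.one_kronecker_one]

end Bounds

/-! ### Random oblivious transfer -/

section Random

variable {A M B : Type} [Fintype A] [DecidableEq A] [Fintype M] [DecidableEq M]
  [Fintype B] [DecidableEq B]

/-- Bob guesses the bit that he did not obtain at random. -/
noncomputable def randomGuess (Q : POVM (Option (Bool × Bool)) B) : POVM (Bool × Bool) B where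
  -- The outcome Abort is spread evenly over the four guesses, hence the weight 1/4.
  op x := (1 / 2 : ℝ) • (Q.op (some (false, x.1)) + Q.op (some (true, x.2)))
    + (1 / 4 : ℝ) • Q.op none
  posSemidef x := (((Q.posSemidef _).add (Q.posSemidef _)).smul (by norm_num)).add
    ((Q.posSemidef _).smul (by norm_num))
  sum_eq_one := by
    have h := Q.sum_eq_one
    rw [Fintype.sum_option] at h
    simp only [Fintype.sum_prod_type, Fintype.sum_bool] at h ⊢
    rw [← h]
    module

namespace RandomOT

variable (P : RandomOT A M B)

theorem alice_value_le_one {K : Type} [Fintype K] [DecidableEq K] (S : CheatingAlice Bool K M) :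
    ∑ b : Bool, ∑ y : Bool, cheatAliceProb P.rounds P.msgStart S P.bob b (some (b, y)) ≤ 1 := by
  simp only [cheatAliceProb, sum_prob_tensorLeft]
  refine sum_prob_tensorLeft_le
    (prob_run_one S.unitary P.bob.unitary S.start P.msgStart P.bob.start P.rounds) S.guess fun b => ?_
  have h := P.bob.meas.one_sub_sum_posSemidef
    (Finset.univ.map ⟨fun y => some (b, y), fun y y' h => by simpa using h⟩)
  rwa [Finset.sum_map] at h

theorem bob_value_le_one {K : Type} [Fintype K] [DecidableEq K]
    (S : CheatingBob (Bool × Bool) M K) :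
    ∑ x : Bool × Bool, cheatBobProb P.rounds P.msgStart P.alice S (some x) x ≤ 1 := by
  simp only [cheatBobProb]
  refine sum_prob_kronecker_le
    (prob_run_one P.alice.unitary S.unitary P.alice.start P.msgStart S.start P.rounds) S.guess fun x => ?_
  simpa using P.alice.meas.one_sub_sum_posSemidef {some x}

theorem alice_value_le_aliceCheat {K : Type} [Fintype K] [DecidableEq K]
    (S : CheatingAlice Bool K M) :
    ∑ b : Bool, ∑ y : Bool, cheatAliceProb P.rounds P.msgStart S P.bob b (some (b, y))
      ≤ P.aliceCheat := by
  refine le_csSup ⟨1, ?_⟩ ⟨K, _, _, S, rfl⟩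
  rintro _ ⟨K, _, _, S, rfl⟩
  exact P.alice_value_le_one S

theorem bob_value_le_bobCheat {K : Type} [Fintype K] [DecidableEq K]
    (S : CheatingBob (Bool × Bool) M K) :
    ∑ x : Bool × Bool, cheatBobProb P.rounds P.msgStart P.alice S (some x) x ≤ P.bobCheat := by
  refine le_csSup ⟨1, ?_⟩ ⟨K, _, _, S, rfl⟩
  rintro _ ⟨K, _, _, S, rfl⟩
  exact P.bob_value_le_one S

/-- Honest play followed by a random guess of the other bit wins with probability at least 1/2. The
lower bound also places `B_OT` in the range where `f` inverts `g`. -/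
theorem bobCheat_mem : P.bobCheat ∈ Set.Icc (1 / 2 : ℝ) 1 := by
  constructor
  · refine le_trans ?_ (P.bob_value_le_bobCheat
      ⟨P.bob.start, P.bob.unitary, (randomGuess P.bob.meas).ignoreMessage⟩)
    have h : ∀ x : Bool × Bool, (1 / 8 : ℝ) ≤ cheatBobProb P.rounds P.msgStart P.alice
        ⟨P.bob.start, P.bob.unitary, (randomGuess P.bob.meas).ignoreMessage⟩ (some x) x := by
      intro x
      have h0 := P.honest x false x.1
      have h1 := P.honest x true x.2
      simp only [bitAt, if_true, Bool.false_eq_true, if_false, honestProb] at h0 h1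
      set ψ := run P.alice.unitary P.bob.unitary P.alice.start P.msgStart P.bob.start P.rounds
      have hsplit : P.alice.meas.op (some x) ⊗ₖ ((1 : Matrix M M ℂ) ⊗ₖ (randomGuess P.bob.meas).op x)
          = (1 / 2 : ℝ) • (P.alice.meas.op (some x)
              ⊗ₖ ((1 : Matrix M M ℂ) ⊗ₖ P.bob.meas.op (some (false, x.1))))
            + (1 / 2 : ℝ) • (P.alice.meas.op (some x)
              ⊗ₖ ((1 : Matrix M M ℂ) ⊗ₖ P.bob.meas.op (some (true, x.2))))
            + (1 / 4 : ℝ) • (P.alice.meas.op (some x)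
              ⊗ₖ ((1 : Matrix M M ℂ) ⊗ₖ P.bob.meas.op none)) := by
        ext p q
        simp [randomGuess]
        ring
      have hn := prob_nonneg ψ ((P.alice.meas.posSemidef (some x)).kronecker
        ((Matrix.PosSemidef.one (n := M) (R := ℂ)).kronecker (P.bob.meas.posSemidef none)))
      show 1 / 8 ≤ prob ψ (P.alice.meas.op (some x)
        ⊗ₖ ((1 : Matrix M M ℂ) ⊗ₖ (randomGuess P.bob.meas).op x))
      rw [hsplit, prob_add, prob_add, prob_smul, prob_smul, prob_smul, h0, h1]
      linarith
    calc (1 / 2 : ℝ) = ∑ _x : Bool × Bool, (1 / 8 : ℝ) := by simp; norm_num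
      _ ≤ _ := Finset.sum_le_sum fun x _ => h x
  · refine csSup_le ⟨_, B, _, _,
      ⟨P.bob.start, P.bob.unitary, (randomGuess P.bob.meas).ignoreMessage⟩, rfl⟩ ?_
    rintro _ ⟨K, _, _, S, rfl⟩
    exact P.bob_value_le_one S

theorem half_le_aliceCheat_mul : 1 / 2 ≤ P.aliceCheat * f P.bobCheat := by
  refine half_le_mul_f (α := Pi.single P.alice.start 1) (by simp [prob]) P.msgStart
    (Pi.single P.bob.start 1) P.rounds P.alice.unitary P.bob.unitary
    (P := fun x => P.alice.meas.op (some x)) (fun x => P.alice.meas.posSemidef _) ?_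
    (Q := fun c y => P.bob.meas.op (some (c, y))) (fun c y => P.bob.meas.posSemidef _)
    P.bobCheat_mem (fun K _ _ S => ?_) (fun K _ _ S => ?_) ?_
  · have h := P.alice.meas.sum_eq_one
    rw [Fintype.sum_option] at h
    rw [← h, add_sub_cancel_right]
    exact P.alice.meas.posSemidef _
  · have h := P.alice_value_le_aliceCheat S
    simpa only [cheatAliceProb, sum_prob_tensorLeft, run_eq_evolve, single_eq_prodVec]
      using h
  · have h := P.bob_value_le_bobCheat S
    simpa only [cheatBobProb, run_eq_evolve, single_eq_prodVec] using h
  · have h : ∀ c x, prob (evolve P.alice.unitary P.bob.unitary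
        (prodVec (Pi.single P.alice.start 1) P.msgStart (Pi.single P.bob.start 1)) P.rounds)
        (P.alice.meas.op (some x) ⊗ₖ
          ((1 : Matrix M M ℂ) ⊗ₖ P.bob.meas.op (some (c, bitAt x c)))) = 1 / 8 := by
      intro c x
      have h := P.honest x c (bitAt x c)
      rw [if_pos rfl] at h
      rw [← h, honestProb, run_eq_evolve, single_eq_prodVec]
    simp only [h]
    simp
    norm_num

end RandomOT

end Random

/-! ### Inputs held in superposition -/

section Control

variable {A M B Y : Type} [Fintype A] [DecidableEq A] [Fintype M] [DecidableEq M]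
  [Fintype B] [DecidableEq B] [Fintype Y] [DecidableEq Y]

/-- The unitary that applies `D y` if the register `Y` holds `y`. -/
def control (D : Y → Matrix.unitaryGroup (M × B) ℂ) : Matrix.unitaryGroup (M × Y × B) ℂ :=
  ⟨Matrix.of fun p q => if p.2.1 = q.2.1
      then (D p.2.1 : Matrix (M × B) (M × B) ℂ) (p.1, p.2.2) (q.1, q.2.2) else 0, by
    let e : M × Y × B ≃ (M × B) × Y :=
      ⟨fun p => ((p.1, p.2.2), p.2.1), fun p => (p.1.1, p.2, p.1.2), fun _ => rfl, fun _ => rfl⟩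
    have h : (Matrix.of fun p q : M × Y × B => if p.2.1 = q.2.1
        then (D p.2.1 : Matrix (M × B) (M × B) ℂ) (p.1, p.2.2) (q.1, q.2.2) else 0)
        = (Matrix.blockDiagonal fun y => (D y : Matrix (M × B) (M × B) ℂ)).submatrix e e := by
      ext p q
      simp [Matrix.blockDiagonal_apply, e]
    have hD : ∀ y, (D y : Matrix (M × B) (M × B) ℂ)ᴴ * (D y : Matrix (M × B) (M × B) ℂ) = 1 :=
      fun y => Matrix.mem_unitaryGroup_iff'.1 (D y).2
    rw [Matrix.mem_unitaryGroup_iff', Matrix.star_eq_conjTranspose, h,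
      Matrix.conjTranspose_submatrix, Matrix.submatrix_mul_equiv, Matrix.blockDiagonal_conjTranspose,
      ← Matrix.blockDiagonal_mul]
    simp only [hD]
    have h1 : (Matrix.blockDiagonal fun _ : Y => (1 : Matrix (M × B) (M × B) ℂ)) = 1 :=
      Matrix.blockDiagonal_one
    rw [h1, Matrix.submatrix_one_equiv]⟩

/-- The part of a vector in which Bob's register `Y` holds `y`. -/
def sliceBob (ψ : A × M × Y × B → ℂ) (y : Y) : A × M × B → ℂ := fun p => ψ (p.1, p.2.1, y, p.2.2)

/-- The part of a vector in which Alice's register `Y` holds `y`. -/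
def sliceAlice (ψ : (Y × A) × M × B → ℂ) (y : Y) : A × M × B → ℂ := fun p => ψ ((y, p.1), p.2)

theorem sliceBob_control_mulVec (D : Y → Matrix.unitaryGroup (M × B) ℂ) (ψ : A × M × Y × B → ℂ)
    (y : Y) : sliceBob (((1 : Matrix A A ℂ) ⊗ₖ (control D : Matrix (M × Y × B) (M × Y × B) ℂ)) *ᵥ ψ) y
      = ((1 : Matrix A A ℂ) ⊗ₖ (D y : Matrix (M × B) (M × B) ℂ)) *ᵥ sliceBob ψ y := by
  funext p
  simp only [sliceBob, one_kronecker_mulVec_apply, control, Matrix.of_apply, Fintype.sum_prod_type]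
  refine Finset.sum_congr rfl fun m _ => ?_
  rw [Finset.sum_eq_single y]
  · simp
  · intro y' _ hy; simp [hy.symm]
  · simp

theorem sliceBob_tensorLeft_mulVec (X : Matrix (A × M) (A × M) ℂ) (ψ : A × M × Y × B → ℂ) (y : Y) :
    sliceBob (tensorLeft X (1 : Matrix (Y × B) (Y × B) ℂ) *ᵥ ψ) y
      = tensorLeft X (1 : Matrix B B ℂ) *ᵥ sliceBob ψ y := by
  funext p
  simp only [sliceBob, tensorLeft_one_mulVec_apply]

/-- Controlled unitaries never change the control register, so its branches evolve independently,
each as in the protocol with that input. -/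
theorem sliceBob_evolve (U : ℕ → Matrix.unitaryGroup (A × M) ℂ)
    (V : Y → ℕ → Matrix.unitaryGroup (M × B) ℂ) (ψ₀ : A × M × Y × B → ℂ) (n : ℕ) (y : Y) :
    sliceBob (evolve U (fun i => control fun y => V y i) ψ₀ n) y
      = evolve U (V y) (sliceBob ψ₀ y) n := by
  induction n with
  | zero => rfl
  | succ n ih => rw [evolve, evolve, sliceBob_control_mulVec, sliceBob_tensorLeft_mulVec, ih]

/-- The unitary of Alice that applies `D y` if the register `Y` holds `y`. -/
def controlAlice (D : Y → Matrix.unitaryGroup (A × M) ℂ) :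
    Matrix.unitaryGroup ((Y × A) × M) ℂ :=
  swapU (control fun y => swapU (D y))

theorem sliceAlice_control_mulVec (D : Y → Matrix.unitaryGroup (A × M) ℂ)
    (ψ : (Y × A) × M × B → ℂ) (y : Y) :
    sliceAlice (tensorLeft (controlAlice D : Matrix ((Y × A) × M) ((Y × A) × M) ℂ)
        (1 : Matrix B B ℂ) *ᵥ ψ) y
      = tensorLeft (D y : Matrix (A × M) (A × M) ℂ) (1 : Matrix B B ℂ) *ᵥ sliceAlice ψ y := by
  funext p
  simp only [sliceAlice, tensorLeft_one_mulVec_apply, controlAlice, control, swapU_apply,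
    Matrix.of_apply, Fintype.sum_prod_type]
  rw [Finset.sum_eq_single y]
  · simp
  · intro y' _ hy; simp [hy.symm]
  · simp

theorem sliceAlice_kronecker_mulVec (X : Matrix (M × B) (M × B) ℂ) (ψ : (Y × A) × M × B → ℂ)
    (y : Y) : sliceAlice (((1 : Matrix (Y × A) (Y × A) ℂ) ⊗ₖ X) *ᵥ ψ) y
      = ((1 : Matrix A A ℂ) ⊗ₖ X) *ᵥ sliceAlice ψ y := by
  funext p
  simp only [sliceAlice, one_kronecker_mulVec_apply]

theorem sliceAlice_evolve (U : Y → ℕ → Matrix.unitaryGroup (A × M) ℂ)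
    (V : ℕ → Matrix.unitaryGroup (M × B) ℂ) (ψ₀ : (Y × A) × M × B → ℂ) (n : ℕ) (y : Y) :
    sliceAlice (evolve (fun i => controlAlice fun y => U y i) V ψ₀ n) y
      = evolve (U y) V (sliceAlice ψ₀ y) n := by
  induction n with
  | zero => rfl
  | succ n ih => rw [evolve, evolve, sliceAlice_kronecker_mulVec, sliceAlice_control_mulVec, ih]

/-- The operator that reads out the private space if the register holds `y`. -/
def readOut (B : Type) [DecidableEq B] (y : Y) : Matrix B (Y × B) ℂ := Matrix.of fun b p => if p = (y, b) then 1 else 0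

theorem sum_readOut : ∑ y : Y, (readOut B y)ᴴ * readOut B y = 1 := by
  ext p q
  simp only [Matrix.sum_apply, Matrix.mul_apply, readOut, Matrix.conjTranspose_apply,
    Matrix.of_apply, Matrix.one_apply]
  rw [Finset.sum_eq_single p.1, Finset.sum_eq_single p.2]
  · simp [eq_comm]
  · intro b _ hb
    have : p ≠ (p.1, b) := fun h => hb (congrArg Prod.snd h).symm
    simp [this]
  · simp
  · intro y _ hy
    refine Finset.sum_eq_zero fun b _ => ?_
    have : p ≠ (y, b) := fun h => hy (congrArg Prod.fst h).symm
    simp [this]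
  · simp

/-- The effect `E` together with the event that the register holds `y`. -/
def liftEffect (y : Y) (E : Matrix B B ℂ) : Matrix (Y × B) (Y × B) ℂ :=
  (readOut B y)ᴴ * E * readOut B y

theorem liftEffect_posSemidef (y : Y) {E : Matrix B B ℂ} (hE : E.PosSemidef) :
    (liftEffect y E).PosSemidef :=
  hE.conjTranspose_mul_mul_same _

theorem one_sub_sum_liftEffect_posSemidef {E : Y → Matrix B B ℂ}
    (hE : ∀ y, (1 - E y).PosSemidef) : (1 - ∑ y, liftEffect y (E y)).PosSemidef := by
  rw [← sum_readOut, ← Finset.sum_sub_distrib]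
  refine posSemidef_sum _ fun y _ => ?_
  have := liftEffect_posSemidef y (hE y)
  simpa [liftEffect, Matrix.mul_sub, Matrix.sub_mul] using this

theorem prob_tensorLeft_liftEffect (ψ : A × M × Y × B → ℂ) (X : Matrix (A × M) (A × M) ℂ) (y : Y)
    (E : Matrix B B ℂ) :
    prob ψ (tensorLeft X (liftEffect y E)) = prob (sliceBob ψ y) (tensorLeft X E) := by
  have h : X ⊗ₖ liftEffect y E = ((1 : Matrix (A × M) (A × M) ℂ) ⊗ₖ readOut B y)ᴴ * (X ⊗ₖ E)
      * ((1 : Matrix (A × M) (A × M) ℂ) ⊗ₖ readOut B y) := by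
    rw [Matrix.conjTranspose_kronecker, ← Matrix.mul_kronecker_mul, ← Matrix.mul_kronecker_mul]
    simp [liftEffect]
  rw [prob_tensorLeft, prob_tensorLeft, h, ← prob_mulVec]
  congr 1
  funext p
  rw [one_kronecker_mulVec_apply]
  simp [readOut, grp, sliceBob]

theorem prob_liftEffect_kronecker {L : Type} [Fintype L] [DecidableEq L] (ψ : (Y × A) × L → ℂ)
    (y : Y) (P : Matrix A A ℂ) (X : Matrix L L ℂ) :
    prob ψ (liftEffect y P ⊗ₖ X) = prob (fun p : A × L => ψ ((y, p.1), p.2)) (P ⊗ₖ X) := by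
  have h : liftEffect y P ⊗ₖ X = (readOut A y ⊗ₖ (1 : Matrix L L ℂ))ᴴ * (P ⊗ₖ X)
      * (readOut A y ⊗ₖ (1 : Matrix L L ℂ)) := by
    rw [Matrix.conjTranspose_kronecker, ← Matrix.mul_kronecker_mul, ← Matrix.mul_kronecker_mul]
    simp [liftEffect]
  rw [h, ← prob_mulVec]
  congr 1
  funext p
  rw [kronecker_one_mulVec_apply]
  simp [readOut]

/-- The superposition, with amplitudes `c`, of the basis states `s y`. -/
def superposition (c : ℂ) (s : Y → B) : Y × B → ℂ := fun p => if p.2 = s p.1 then c else 0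

theorem superposition_slice (c : ℂ) (s : Y → B) (y : Y) :
    (fun b => superposition c s (y, b)) = c • Pi.single (s y) 1 := by
  funext b
  by_cases h : b = s y
  · subst h; simp [superposition]
  · simp [superposition, h]

theorem prob_superposition (c : ℂ) (s : Y → B) :
    prob (superposition c s) 1 = Fintype.card Y * ‖c‖ ^ 2 := by
  rw [prob_one, Fintype.sum_prod_type]
  have : ∀ y, ∑ b, ‖superposition c s (y, b)‖ ^ 2 = ‖c‖ ^ 2 := by
    intro y
    rw [Finset.sum_eq_single (s y)]
    · simp [superposition]
    · intro b _ hb; simp [superposition, hb]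
    · simp
  simp [this]

theorem evolve_smul (U : ℕ → Matrix.unitaryGroup (A × M) ℂ)
    (V : ℕ → Matrix.unitaryGroup (M × B) ℂ) (c : ℂ) (ψ₀ : A × M × B → ℂ) (n : ℕ) :
    evolve U V (c • ψ₀) n = c • evolve U V ψ₀ n := by
  induction n with
  | zero => rfl
  | succ n ih => rw [evolve, evolve, ih, Matrix.mulVec_smul, Matrix.mulVec_smul]

theorem prob_smul_vec {H : Type} [Fintype H] (c : ℂ) (ψ : H → ℂ) (E : Matrix H H ℂ) :
    prob (c • ψ) E = ‖c‖ ^ 2 * prob ψ E := by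
  unfold prob
  rw [Matrix.mulVec_smul, star_smul, smul_dotProduct, dotProduct_smul, smul_smul, smul_eq_mul,
    Complex.star_def, ← Complex.normSq_eq_conj_mul_self, Complex.re_ofReal_mul,
    Complex.normSq_eq_norm_sq]

theorem sliceBob_prodVec (α : A → ℂ) (m₀ : M) (c : ℂ) (s : Y → B) (y : Y) :
    sliceBob (prodVec α m₀ (superposition c s)) y = c • prodVec α m₀ (Pi.single (s y) 1) := by
  funext p
  have := congrFun (superposition_slice c s y) p.2.2
  simp only [Pi.smul_apply, smul_eq_mul] at this
  simp only [sliceBob, prodVec, tens, Pi.smul_apply, smul_eq_mul, this]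
  ring

theorem sliceAlice_prodVec (c : ℂ) (s : Y → A) (m₀ : M) (β : B → ℂ) (y : Y) :
    sliceAlice (prodVec (superposition c s) m₀ β) y = c • prodVec (Pi.single (s y) 1) m₀ β := by
  funext p
  have := congrFun (superposition_slice c s y) p.1
  simp only [Pi.smul_apply, smul_eq_mul] at this
  simp only [sliceAlice, prodVec, tens, Pi.smul_apply, smul_eq_mul, this]
  ring

end Control

/-! ### Oblivious transfer with inputs -/

section Input

variable {A M B : Type} [Fintype A] [DecidableEq A] [Fintype M] [DecidableEq M]
  [Fintype B] [DecidableEq B]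

theorem prob_kronecker_le_one {J L : Type} [Fintype J] [DecidableEq J] [Fintype L] [DecidableEq L]
    {ψ : J × L → ℂ} (hψ : prob ψ 1 = 1) {X : Matrix J J ℂ} {E : Matrix L L ℂ}
    (hX : (1 - X).PosSemidef) (hE : E.PosSemidef) (hE1 : (1 - E).PosSemidef) :
    prob ψ (X ⊗ₖ E) ≤ 1 := by
  calc prob ψ (X ⊗ₖ E) ≤ prob ψ ((1 : Matrix J J ℂ) ⊗ₖ E) := prob_mono _ (by
        rw [← sub_kronecker]; exact hX.kronecker hE)
    _ ≤ prob ψ ((1 : Matrix J J ℂ) ⊗ₖ (1 : Matrix L L ℂ)) := prob_mono _ (by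
        rw [← kronecker_sub]; exact Matrix.PosSemidef.one.kronecker hE1)
    _ = 1 := by rw [Matrix.one_kronecker_one, hψ]

/-- Bob guesses the bit `x₁` at random after he asked for `x₀`. -/
noncomputable def inputGuess (Q : POVM (Option Bool) B) : POVM (Bool × Bool) B where
  op x := (1 / 2 : ℝ) • Q.op (some x.1) + (1 / 4 : ℝ) • Q.op none
  posSemidef x := ((Q.posSemidef _).smul (by norm_num)).add ((Q.posSemidef _).smul (by norm_num))
  sum_eq_one := by
    have h := Q.sum_eq_one
    rw [Fintype.sum_option] at h
    simp only [Fintype.sum_prod_type, Fintype.sum_bool] at h ⊢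
    rw [← h]
    module

namespace InputOT

variable (P : InputOT A M B)

theorem alice_value_le_one {K : Type} [Fintype K] [DecidableEq K] (S : CheatingAlice Bool K M) :
    ∑ b : Bool, (1 / 2) *
      ∑ y : Bool, cheatAliceProb P.rounds P.msgStart S (P.bob b) b (some y) ≤ 1 := by
  have h : ∀ b : Bool,
      ∑ y : Bool, cheatAliceProb P.rounds P.msgStart S (P.bob b) b (some y) ≤ 1 := by
    intro b
    simp only [cheatAliceProb, sum_prob_tensorLeft]
    rw [prob_tensorLeft]
    refine prob_kronecker_le_one ?_ ?_ (posSemidef_sum _ fun y _ => (P.bob b).meas.posSemidef _) ?_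
    · rw [← Matrix.one_kronecker_one, ← prob_tensorLeft, tensorLeft_one, prob_run_one]
    · simpa using S.guess.one_sub_sum_posSemidef {b}
    · have h := (P.bob b).meas.one_sub_sum_posSemidef
        (Finset.univ.map ⟨fun y => some y, fun y y' h => by simpa using h⟩)
      rwa [Finset.sum_map] at h
  rw [Fintype.sum_bool]
  linarith [h true, h false]

theorem bob_value_le_one {K : Type} [Fintype K] [DecidableEq K]
    (S : CheatingBob (Bool × Bool) M K) :
    ∑ x : Bool × Bool, (1 / 4) *
      cheatBobProb P.rounds P.msgStart (P.alice x) S (some ()) x ≤ 1 := by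
  have h : ∀ x, cheatBobProb P.rounds P.msgStart (P.alice x) S (some ()) x ≤ 1 := by
    intro x
    refine prob_kronecker_le_one (prob_run_one _ _ _ _ _ _) ?_ (S.guess.posSemidef _) ?_
    · simpa using (P.alice x).meas.one_sub_sum_posSemidef {some ()}
    · simpa using S.guess.one_sub_sum_posSemidef {x}
  calc ∑ x : Bool × Bool, (1 / 4) * cheatBobProb P.rounds P.msgStart (P.alice x) S (some ()) x
      ≤ ∑ _x : Bool × Bool, (1 / 4 : ℝ) := Finset.sum_le_sum fun x _ => by linarith [h x]
    _ = 1 := by simp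

theorem alice_value_le_aliceCheat {K : Type} [Fintype K] [DecidableEq K]
    (S : CheatingAlice Bool K M) :
    ∑ b : Bool, (1 / 2) * ∑ y : Bool, cheatAliceProb P.rounds P.msgStart S (P.bob b) b (some y)
      ≤ P.aliceCheat := by
  refine le_csSup ⟨1, ?_⟩ ⟨K, _, _, S, rfl⟩
  rintro _ ⟨K, _, _, S, rfl⟩
  exact P.alice_value_le_one S

theorem bob_value_le_bobCheat {K : Type} [Fintype K] [DecidableEq K]
    (S : CheatingBob (Bool × Bool) M K) :
    ∑ x : Bool × Bool, (1 / 4) * cheatBobProb P.rounds P.msgStart (P.alice x) S (some ()) x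
      ≤ P.bobCheat := by
  refine le_csSup ⟨1, ?_⟩ ⟨K, _, _, S, rfl⟩
  rintro _ ⟨K, _, _, S, rfl⟩
  exact P.bob_value_le_one S

theorem bobCheat_mem : P.bobCheat ∈ Set.Icc (1 / 2 : ℝ) 1 := by
  constructor
  · refine le_trans ?_ (P.bob_value_le_bobCheat ⟨(P.bob false).start, (P.bob false).unitary,
      (inputGuess (P.bob false).meas).ignoreMessage⟩)
    have h : ∀ x : Bool × Bool, (1 / 2 : ℝ) ≤ cheatBobProb P.rounds P.msgStart (P.alice x)
        ⟨(P.bob false).start, (P.bob false).unitary,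
          (inputGuess (P.bob false).meas).ignoreMessage⟩ (some ()) x := by
      intro x
      have h0 := P.honest x false
      simp only [bitAt, Bool.false_eq_true, if_false, honestProb] at h0
      set ψ := run (P.alice x).unitary (P.bob false).unitary (P.alice x).start P.msgStart
        (P.bob false).start P.rounds
      have hsplit : (P.alice x).meas.op (some ())
            ⊗ₖ ((1 : Matrix M M ℂ) ⊗ₖ (inputGuess (P.bob false).meas).op x)
          = (1 / 2 : ℝ) • ((P.alice x).meas.op (some ())
              ⊗ₖ ((1 : Matrix M M ℂ) ⊗ₖ (P.bob false).meas.op (some x.1)))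
            + (1 / 4 : ℝ) • ((P.alice x).meas.op (some ())
              ⊗ₖ ((1 : Matrix M M ℂ) ⊗ₖ (P.bob false).meas.op none)) := by
        ext p q
        simp [inputGuess]
        ring
      have hn := prob_nonneg ψ (((P.alice x).meas.posSemidef (some ())).kronecker
        ((Matrix.PosSemidef.one (n := M) (R := ℂ)).kronecker ((P.bob false).meas.posSemidef none)))
      show 1 / 2 ≤ prob ψ ((P.alice x).meas.op (some ())
        ⊗ₖ ((1 : Matrix M M ℂ) ⊗ₖ (inputGuess (P.bob false).meas).op x))
      rw [hsplit, prob_add, prob_smul, prob_smul, h0]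
      linarith
    calc (1 / 2 : ℝ) = ∑ _x : Bool × Bool, (1 / 4 * (1 / 2) : ℝ) := by simp
      _ ≤ _ := Finset.sum_le_sum fun x _ => mul_le_mul_of_nonneg_left (h x) (by norm_num)
  · refine csSup_le ⟨_, B, _, _, ⟨(P.bob false).start, (P.bob false).unitary,
      (inputGuess (P.bob false).meas).ignoreMessage⟩, rfl⟩ ?_
    rintro _ ⟨K, _, _, S, rfl⟩
    exact P.bob_value_le_one S

/-- The honest inputs are put in uniform superposition and read out with the final measurement. The
squared amplitudes 1/4 and 1/2 reproduce the uniform priors, so every cheating strategy keeps its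
winning probability, and each honest triple `(x, b)` with the right output has probability 1/8. -/
theorem half_le_aliceCheat_mul : 1 / 2 ≤ P.aliceCheat * f P.bobCheat := by
  have hcA : ‖(1 / 2 : ℂ)‖ ^ 2 = 1 / 4 := by norm_num
  have hcB : ‖(((√2)⁻¹ : ℝ) : ℂ)‖ ^ 2 = 1 / 2 := by
    rw [Complex.norm_real, Real.norm_eq_abs, sq_abs, inv_pow, Real.sq_sqrt (by norm_num)]
    norm_num
  set cB : ℂ := (((√2)⁻¹ : ℝ) : ℂ)
  refine half_le_mul_f (α := superposition (1 / 2) fun x => (P.alice x).start)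
    (by rw [prob_superposition, hcA]; simp) P.msgStart
    (superposition cB fun b => (P.bob b).start) P.rounds
    (fun i => controlAlice fun x => (P.alice x).unitary i)
    (fun i => control fun b => (P.bob b).unitary i)
    (P := fun x => liftEffect x ((P.alice x).meas.op (some ())))
    (fun x => liftEffect_posSemidef _ ((P.alice x).meas.posSemidef _))
    (one_sub_sum_liftEffect_posSemidef fun x => by
      simpa using (P.alice x).meas.one_sub_sum_posSemidef {some ()})
    (Q := fun c y => liftEffect c ((P.bob c).meas.op (some y)))
    (fun c y => liftEffect_posSemidef _ ((P.bob c).meas.posSemidef _))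
    P.bobCheat_mem (fun K _ _ S => ?_) (fun K _ _ S => ?_) ?_
  · refine le_trans (le_of_eq ?_) (P.alice_value_le_aliceCheat S)
    refine Finset.sum_congr rfl fun c _ => ?_
    rw [← sum_prob_tensorLeft, Finset.mul_sum]
    refine Finset.sum_congr rfl fun y _ => ?_
    rw [prob_tensorLeft_liftEffect,
      sliceBob_evolve S.unitary (fun b => (P.bob b).unitary), sliceBob_prodVec, evolve_smul,
      prob_smul_vec, hcB, cheatAliceProb, run_eq_evolve, single_eq_prodVec]
  · refine le_trans (le_of_eq ?_) (P.bob_value_le_bobCheat S)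
    refine Finset.sum_congr rfl fun x _ => ?_
    rw [prob_liftEffect_kronecker]
    have h := sliceAlice_evolve (fun x => (P.alice x).unitary) S.unitary
      (prodVec (superposition (1 / 2) fun x => (P.alice x).start) P.msgStart
        (Pi.single S.start 1)) P.rounds x
    rw [sliceAlice_prodVec, evolve_smul] at h
    unfold sliceAlice at h
    rw [h, prob_smul_vec, hcA, cheatBobProb, run_eq_evolve, single_eq_prodVec]
  · have h : ∀ c x, prob (evolve (fun i => controlAlice fun x => (P.alice x).unitary i)
          (fun i => control fun b => (P.bob b).unitary i)
          (prodVec (superposition (1 / 2) fun x => (P.alice x).start) P.msgStart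
            (superposition cB fun b => (P.bob b).start)) P.rounds)
        (liftEffect x ((P.alice x).meas.op (some ())) ⊗ₖ ((1 : Matrix M M ℂ) ⊗ₖ
          liftEffect c ((P.bob c).meas.op (some (bitAt x c))))) = 1 / 8 := by
      intro c x
      rw [prob_liftEffect_kronecker]
      have h1 := sliceAlice_evolve (fun x => (P.alice x).unitary)
        (fun i => control fun b => (P.bob b).unitary i)
        (prodVec (superposition (1 / 2) fun x => (P.alice x).start) P.msgStart
            (superposition cB fun b => (P.bob b).start)) P.rounds x
      rw [sliceAlice_prodVec, evolve_smul] at h1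
      unfold sliceAlice at h1
      rw [h1, prob_smul_vec, hcA, ← tensorLeft_kronecker, prob_tensorLeft_liftEffect,
        sliceBob_evolve (P.alice x).unitary (fun b => (P.bob b).unitary), sliceBob_prodVec,
        evolve_smul, prob_smul_vec, hcB, tensorLeft_kronecker, ← single_eq_prodVec,
        ← run_eq_evolve]
      have h2 := P.honest x c
      rw [honestProb] at h2
      rw [h2]
      norm_num
    simp only [h]
    norm_num

end InputOT

end Input

end QuantumOT

theorem theorem1 :
    -- `g` maps `[1/2, 1]` bijectively onto `[0, 1]`, and `f` is its inverse where it is applied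
    (Set.BijOn QuantumOT.g (Set.Icc (1 / 2) 1) (Set.Icc 0 1) ∧
      ∀ z ∈ Set.Icc (2 / 27 : ℝ) 1,
        QuantumOT.f z ∈ Set.Icc (1 / 2 : ℝ) 1 ∧ QuantumOT.g (QuantumOT.f z) = z) ∧
    -- random oblivious transfer
    (∀ (A M B : Type) [Fintype A] [DecidableEq A] [Fintype M] [DecidableEq M]
        [Fintype B] [DecidableEq B] (P : QuantumOT.RandomOT A M B),
      P.bobCheat ∈ Set.Icc (1 / 2 : ℝ) 1 ∧
      P.aliceCheat * QuantumOT.f P.bobCheat ≥ 1 / 2 ∧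
      P.bias ≥ QuantumOT.biasBound) ∧
    -- oblivious transfer with inputs
    (∀ (A M B : Type) [Fintype A] [DecidableEq A] [Fintype M] [DecidableEq M]
        [Fintype B] [DecidableEq B] (P : QuantumOT.InputOT A M B),
      P.bobCheat ∈ Set.Icc (1 / 2 : ℝ) 1 ∧
      P.aliceCheat * QuantumOT.f P.bobCheat ≥ 1 / 2 ∧
      P.bias ≥ QuantumOT.biasBound) ∧
    -- the numerical value of the bound on the bias
    |QuantumOT.biasBound - 0.0586| < 0.00005 := by
  refine ⟨⟨QuantumOT.g_bijOn, fun z hz => QuantumOT.f_spec hz⟩, ?_, ?_,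
    QuantumOT.abs_biasBound_sub_lt⟩
  · intro A M B _ _ _ _ _ _ P
    exact ⟨P.bobCheat_mem, P.half_le_aliceCheat_mul,
      QuantumOT.biasBound_le_of_product P.bobCheat_mem P.half_le_aliceCheat_mul⟩
  · intro A M B _ _ _ _ _ _ P
    exact ⟨P.bobCheat_mem, P.half_le_aliceCheat_mul,
      QuantumOT.biasBound_le_of_product P.bobCheat_mem P.half_le_aliceCheat_mul⟩
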